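/- Let $K$ be a field and let $2\le k\le n$ be integers. Let $A(n,k)$ be the bound quiver algebra over $K$ of the quiver $$1\xleftarrow{\ \alpha_1\ }2\xleftarrow{\ \alpha_2\ }\cdots\xleftarrow{\ \alpha_{n-1}\ }n$$ with relations $\alpha_{i+1}\alpha_i=0$ for $1\le i\le k-2$, that is, the quotient of the path algebra by the two-sided ideal generated by these elements; here paths are composed from left to right, so $\alpha_{i+1}\alpha_i$ is the path $i+2\to i+1\to i$. Modules are right modules, and endomorphisms of a module are multiplied as $(fg)(x)=f(g(x))$. A finitely generated $A$-module $T$ is called tilting if $\operatorname{pd}_A T\le 1$, $\operatorname{Ext}^1_A(T,T)=0$, and there is a short exact sequence $0\to A\to T_0\to T_1\to 0$ with $T_0,T_1\in\operatorname{add}T$. Then the following hold. 1. For all $2\le k\le n$, $\operatorname{gl.dim}A(n,k)=k-1$. 2. For all $2\le k<n$, there is a tilting $A(n,k)$-module $T$ such that $\operatorname{End}_{A(n,k)}T\cong A(n,k+1)$ as $K$-algebras. 3. In particular, for every $n\ge 2$ there are $K$-algebras $B_0,B_1,\dots,B_{n-2}$ such that $B_0$ is isomorphic to the path algebra of the above quiver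 of type $\mathbb A_n$ (without relations) and is hereditary, $B_{i+1}$ is isomorphic to the endomorphism algebra of a tilting $B_i$-module for every $0\le i<n-2$, and $\operatorname{gl.dim}B_{n-2}=n-1$. -/

import Mathlib

open CategoryTheory

universe u

/-! ### Path algebras -/

/-- The underlying vector space of the path algebra `KQ` of a quiver `Q` with vertex type `V`:
it has the set of all paths (the trivial ones included) as a basis. -/
def PathAlgebra (K : Type u) [Field K] (V : Type) [Quiver.{0} V] : Type u :=
  (Σ a : V, Σ b : V, Quiver.Path a b) →₀ K

namespace PathAlgebra

variable (K : Type u) [Field K] {V : Type} [Quiver.{0} V]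

noncomputable instance : AddCommGroup (PathAlgebra K V) :=
  inferInstanceAs (AddCommGroup ((Σ a : V, Σ b : V, Quiver.Path a b) →₀ K))

noncomputable instance : Module K (PathAlgebra K V) :=
  inferInstanceAs (Module K ((Σ a : V, Σ b : V, Quiver.Path a b) →₀ K))

/-- The basis element of the path algebra given by a path. -/
noncomputable def ofPath {a b : V} (p : Quiver.Path a b) : PathAlgebra K V :=
  Finsupp.single (⟨a, b, p⟩ : Σ a : V, Σ b : V, Quiver.Path a b) (1 : K)

open Classical in
/-- The product of two paths, read from left to right: first `p`, then `q`, if `p` ends where `q` starts; zero otherwise. -/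
noncomputable def mulPath (p q : Σ a : V, Σ b : V, Quiver.Path a b) : PathAlgebra K V :=
  if h : p.2.1 = q.1 then
    ofPath K (p.2.2.comp (q.2.2.cast h.symm rfl))
  else 0

/-- The bilinear extension of the product of paths. -/
noncomputable def mulLinear : PathAlgebra K V →ₗ[K] PathAlgebra K V →ₗ[K] PathAlgebra K V :=
  Finsupp.linearCombination K fun p : Σ a : V, Σ b : V, Quiver.Path a b =>
    (Finsupp.linearCombination K fun q : Σ a : V, Σ b : V, Quiver.Path a b => mulPath K p q :
      PathAlgebra K V →ₗ[K] PathAlgebra K V)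

noncomputable instance : Mul (PathAlgebra K V) := ⟨fun x y => mulLinear K x y⟩

/-- The unit is the sum of the trivial paths. -/
noncomputable instance [Fintype V] : One (PathAlgebra K V) :=
  ⟨∑ a : V, ofPath K (Quiver.Path.nil : Quiver.Path a a)⟩

variable {K}

theorem mul_def (x y : PathAlgebra K V) : x * y = mulLinear K x y := rfl

theorem mulLinear_ofPath {a b c d : V} (p : Quiver.Path a b) (q : Quiver.Path c d) :
    mulLinear K (ofPath K p) (ofPath K q) = mulPath K ⟨a, b, p⟩ ⟨c, d, q⟩ := by
  have h1 : mulLinear K (ofPath K p) =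
      (Finsupp.linearCombination K fun q : Σ a : V, Σ b : V, Quiver.Path a b =>
        mulPath K ⟨a, b, p⟩ q : PathAlgebra K V →ₗ[K] PathAlgebra K V) :=
    (Finsupp.linearCombination_single K (1 : K) _).trans (one_smul K _)
  rw [h1]
  exact (Finsupp.linearCombination_single K (1 : K) _).trans (one_smul K _)

theorem ofPath_mul_ofPath {a b c : V} (p : Quiver.Path a b) (q : Quiver.Path b c) :
    ofPath K p * ofPath K q = ofPath K (p.comp q) := by
  rw [mul_def, mulLinear_ofPath, mulPath, dif_pos rfl, Quiver.Path.cast_rfl_rfl]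

theorem ofPath_mul_ofPath_of_ne {a b c d : V} (p : Quiver.Path a b) (q : Quiver.Path c d)
    (h : b ≠ c) : ofPath K p * ofPath K q = 0 := by
  rw [mul_def, mulLinear_ofPath, mulPath, dif_neg h]

theorem linearMap_ext {M : Type*} [AddCommGroup M] [Module K M] {f g : PathAlgebra K V →ₗ[K] M}
    (h : ∀ (a b : V) (p : Quiver.Path a b), f (ofPath K p) = g (ofPath K p)) : f = g :=
  Finsupp.lhom_ext' fun p => LinearMap.ext_ring (h p.1 p.2.1 p.2.2)

theorem assoc_ofPath {a b c d e f : V} (p : Quiver.Path a b) (q : Quiver.Path c d)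
    (r : Quiver.Path e f) :
    ofPath K p * ofPath K q * ofPath K r = ofPath K p * (ofPath K q * ofPath K r) := by
  by_cases h1 : b = c
  · subst h1
    by_cases h2 : d = e
    · subst h2
      simp only [ofPath_mul_ofPath, Quiver.Path.comp_assoc]
    · rw [ofPath_mul_ofPath, ofPath_mul_ofPath_of_ne _ _ h2, ofPath_mul_ofPath_of_ne _ _ h2]
      exact (map_zero (mulLinear K (ofPath K p))).symm
  · have h0 : ofPath K p * ofPath K q = 0 := ofPath_mul_ofPath_of_ne _ _ h1
    have hz : ∀ y : PathAlgebra K V, 0 * y = 0 := fun y => by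
      rw [mul_def, map_zero, LinearMap.zero_apply]
    rw [h0, hz]
    by_cases h2 : d = e
    · subst h2
      rw [ofPath_mul_ofPath, ofPath_mul_ofPath_of_ne _ _ h1]
    · rw [ofPath_mul_ofPath_of_ne _ _ h2]
      exact (map_zero (mulLinear K (ofPath K p))).symm

theorem assoc_aux (x y z : PathAlgebra K V) : x * y * z = x * (y * z) := by
  have key : (mulLinear K (V := V)).compr₂ (mulLinear K) =
      ((LinearMap.llcomp K (PathAlgebra K V) (PathAlgebra K V) (PathAlgebra K V)).flip.comp
        (mulLinear K)).flip.comp (mulLinear K) := by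
    refine linearMap_ext fun a b p => linearMap_ext fun c d q => linearMap_ext fun e f r => ?_
    exact assoc_ofPath p q r
  exact LinearMap.congr_fun (LinearMap.congr_fun (LinearMap.congr_fun key x) y) z

theorem one_mul_aux [Fintype V] (x : PathAlgebra K V) : 1 * x = x := by
  have key : mulLinear K (1 : PathAlgebra K V) = LinearMap.id := by
    refine linearMap_ext fun a b p => ?_
    change mulLinear K (∑ c : V, ofPath K (Quiver.Path.nil : Quiver.Path c c)) (ofPath K p) = _
    rw [map_sum, LinearMap.sum_apply, Finset.sum_eq_single a]
    · exact (ofPath_mul_ofPath _ _).trans (by rw [Quiver.Path.nil_comp]; rfl)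
    · exact fun c _ hc => ofPath_mul_ofPath_of_ne _ _ hc
    · exact fun h => absurd (Finset.mem_univ a) h
  exact LinearMap.congr_fun key x

theorem mul_one_aux [Fintype V] (x : PathAlgebra K V) : x * 1 = x := by
  have key : (mulLinear K).flip (1 : PathAlgebra K V) = LinearMap.id := by
    refine linearMap_ext fun a b p => ?_
    change mulLinear K (ofPath K p) (∑ c : V, ofPath K (Quiver.Path.nil : Quiver.Path c c)) = _
    rw [map_sum, Finset.sum_eq_single b]
    · exact (ofPath_mul_ofPath _ _).trans (by rw [Quiver.Path.comp_nil]; rfl)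
    · exact fun c _ hc => ofPath_mul_ofPath_of_ne _ _ hc.symm
    · exact fun h => absurd (Finset.mem_univ b) h
  exact LinearMap.congr_fun key x

noncomputable instance [Fintype V] : Ring (PathAlgebra K V) where
  __ := (inferInstance : AddCommGroup (PathAlgebra K V))
  left_distrib x y z := map_add (mulLinear K x) y z
  right_distrib x y z := LinearMap.congr_fun (map_add (mulLinear K) x y) z
  zero_mul x := LinearMap.congr_fun (map_zero (mulLinear K)) x
  mul_zero x := map_zero (mulLinear K x)
  mul_assoc := assoc_aux
  one_mul := one_mul_aux
  mul_one := mul_one_aux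

noncomputable instance [Fintype V] : Algebra K (PathAlgebra K V) :=
  Algebra.ofModule (fun r x y => LinearMap.congr_fun (map_smul (mulLinear K) r x) y)
    (fun r x y => map_smul (mulLinear K x) r y)

end PathAlgebra

/-! ### The algebras `A(n, k)` -/

/-- The vertices of the linearly oriented quiver `1 ← 2 ← ⋯ ← n` of type `𝔸ₙ`; the element
`i : Fin n` stands for the vertex with label `i + 1`. -/
def LinearA (n : ℕ) : Type := Fin n

namespace LinearA

instance (n : ℕ) : Fintype (LinearA n) := inferInstanceAs (Fintype (Fin n))

/-- The label in `{1, …, n}` of a vertex. -/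
def label {n : ℕ} (a : LinearA n) : ℕ := Fin.val a + 1

/-- There is exactly one arrow `αᵢ : i + 1 ⟶ i` for each `1 ≤ i < n`, and no other arrow. -/
instance (n : ℕ) : Quiver.{0} (LinearA n) := ⟨fun a b => PLift (a.label = b.label + 1)⟩

end LinearA

/-- The zero relations of `A(n, k)`: the paths `αᵢ₊₁ αᵢ : i + 2 ⟶ i + 1 ⟶ i`, `1 ≤ i ≤ k - 2`,
that is, the paths of length two that start at a vertex with label at most `k`. -/
def zeroRelations (K : Type u) [Field K] (n k : ℕ) : Set (PathAlgebra K (LinearA n)) :=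
  {x | ∃ (a b c : LinearA n) (β : a ⟶ b) (α : b ⟶ c), a.label ≤ k ∧
    x = PathAlgebra.ofPath K β.toPath * PathAlgebra.ofPath K α.toPath}

/-- The bound quiver algebra `A(n, k)`: the path algebra of `1 ← 2 ← ⋯ ← n` modulo the two-sided
ideal generated by `α₂ α₁, …, αₖ₋₁ αₖ₋₂`. -/
abbrev BoundAlgebra (K : Type u) [Field K] (n k : ℕ) : Type u :=
  PathAlgebra K (LinearA n) ⧸ (TwoSidedIdeal.span (zeroRelations K n k)).asIdeal

/-! ### Homological notions for right modules

Right modules over `A` are modules over `Aᵐᵒᵖ`. -/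

/-- The global dimension of a ring: the supremum of the projective dimensions of its right
modules. -/
noncomputable def globalDimension (A : Type u) [Ring A] : WithBot ℕ∞ :=
  ⨆ M : ModuleCat.{u} Aᵐᵒᵖ, projectiveDimension M

/-- A ring is (right) hereditary if submodules of projective right modules are projective. -/
def IsHereditary (A : Type u) [Ring A] : Prop :=
  ∀ (P : Type u) [AddCommGroup P] [Module Aᵐᵒᵖ P], Module.Projective Aᵐᵒᵖ P →
    ∀ N : Submodule Aᵐᵒᵖ P, Module.Projective Aᵐᵒᵖ N

/-- `X` belongs to `add T`: it is a direct summand of a finite direct sum of copies of `T`. -/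
def InAdd (R : Type u) [Ring R] (T X : Type u) [AddCommGroup T] [Module R T]
    [AddCommGroup X] [Module R X] : Prop :=
  ∃ (m : ℕ) (i : X →ₗ[R] (Fin m → T)) (p : (Fin m → T) →ₗ[R] X), p ∘ₗ i = LinearMap.id

/-- (Classical) tilting right modules: finitely generated, of projective dimension at most one,
without self-extensions, and such that there is a short exact sequence
`0 → A → T₀ → T₁ → 0` with `T₀` and `T₁` in `add T`. -/
structure IsTilting (A : Type u) [Ring A] (T : Type u) [AddCommGroup T] [Module Aᵐᵒᵖ T] :
    Prop where
  finite : Module.Finite Aᵐᵒᵖ T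
  projectiveDimension_le_one : HasProjectiveDimensionLE (ModuleCat.of Aᵐᵒᵖ T) 1
  ext_self : Subsingleton (Abelian.Ext.{u} (ModuleCat.of Aᵐᵒᵖ T) (ModuleCat.of Aᵐᵒᵖ T) 1)
  coresolution : ∃ (T₀ T₁ : ModuleCat.{u} Aᵐᵒᵖ) (f : A →ₗ[Aᵐᵒᵖ] T₀) (g : T₀ →ₗ[Aᵐᵒᵖ] T₁),
    InAdd Aᵐᵒᵖ T T₀ ∧ InAdd Aᵐᵒᵖ T T₁ ∧
      Function.Injective f ∧ Function.Exact f g ∧ Function.Surjective g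

/-- `B` is isomorphic, as a `K`-algebra, to the endomorphism algebra of a tilting right
`A`-module. The product of endomorphisms is their composition, `(f g)(x) = f (g x)`. -/
def IsEndOfTilting (K : Type u) [Field K] (A B : Type u) [Ring A] [Algebra K A]
    [Ring B] [Algebra K B] : Prop :=
  ∃ (T : Type u) (_ : AddCommGroup T) (_ : Module K T) (_ : Module Aᵐᵒᵖ T)
    (_ : IsScalarTower K Aᵐᵒᵖ T),
    IsTilting A T ∧ Nonempty (Module.End Aᵐᵒᵖ T ≃ₐ[K] B)

/-! ### Chain systems -/

/-! Count vertices from `0` and let `P_a` be the indecomposable projective module at `a`, with one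
basis vector for each nonzero path starting at `a`. Between two vertices there is at most one path,
and the path `a → b` is nonzero exactly when `GoodPair n k a b`: a path of length at least two
vanishes iff its last two arrows form a relation. An algebra isomorphic to `A(n, k)` is therefore
recognised by a multiplicative spanning family with this zero pattern (`IsChainSystem`,
`boundAlgebraEquiv`), and every Hom computation reduces to arithmetic on pairs of vertices. All
modules used are the quotients `Cyclic t l` of `P_t` by its part at vertices below `l`; the simple
module `S_j` is `Cyclic j j`.

Global dimension. For `0 < j < k` the radical of `P_j` is `S_{j-1}`, so dimension shifting gives `pd
S_j = j` for all `j < k`. For `j ≥ k` the radical of `P_j` is `P_{j-1}`, so `pd S_j ≤ 1`. Every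
module is filtered by vertices with subquotients that are direct sums of copies of one simple
module, so the global dimension is `k - 1`.

Tilting. For `k < n` there are inclusions `P_{k-1} ⊂ P_k ⊂ ⋯ ⊂ P_{n-1}`. Let `T` be the sum of `P_0,
…, P_{k-2}`, `P_{n-1}` and the quotients `P_{n-1}/P_j` for `k - 1 ≤ j ≤ n - 2`. The sequences `0 →
P_j → P_{n-1} → P_{n-1}/P_j → 0` give both the projective resolutions and the coresolution of `A`;
`Ext¹(T, T)` vanishes because every map `P_j → T` extends to `P_{n-1}`. The maps between summands
form the chain `P_0 → ⋯ → P_{k-2} → P_{n-1} → P_{n-1}/P_{k-1} → ⋯`. The old relations persist, and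
exactly one is new: the image of `P_{k-2}` in `P_{n-1}` lies in `P_{k-1}`. Hence `End T` has a chain
system for `k + 1` (`isChainSystem_tiltEnd`).

That the good paths are nonzero in `A(n, k)` is proved by induction on `k` along these endomorphism
algebras, starting from the path algebra `A(n, 2)`. -/

/-- The pairs `(a, b)` of vertices (counted from `0`) of `A(n, k)` such that the path from `a` to `b` exists and
is nonzero. -/
def GoodPair (n k a b : ℕ) : Prop :=
  b ≤ a ∧ a < n ∧ (a ≤ b + 1 ∨ k ≤ a ∧ k ≤ b + 2)

/-- A family `r a b` of elements of an algebra that multiplies like the family of paths of `A(n, k)`,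
read from left to right, and spans the algebra. -/
structure IsChainSystem (K : Type*) {A : Type*} [Field K] [Ring A] [Algebra K A] (n k : ℕ)
    (r : ℕ → ℕ → A) : Prop where
  eq_zero : ∀ a b, ¬ GoodPair n k a b → r a b = 0
  ne_zero : ∀ a b, GoodPair n k a b → r a b ≠ 0
  mul : ∀ a b c, c ≤ b → b ≤ a → r a b * r b c = r a c
  mul_of_ne : ∀ a b c d, b ≠ c → r a b * r c d = 0
  sum_eq_one : ∑ a ∈ Finset.range n, r a a = 1
  mem_span : ∀ x, x ∈ Submodule.span K (Set.range fun p : ℕ × ℕ => r p.1 p.2)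

/-- The version of `IsChainSystem` for paths that are composed from right to left. -/
structure IsLeftChainSystem (K : Type*) {R : Type*} [Field K] [Ring R] [Algebra K R] (n k : ℕ)
    (s : ℕ → ℕ → R) : Prop where
  eq_zero : ∀ a b, ¬ GoodPair n k a b → s a b = 0
  ne_zero : ∀ a b, GoodPair n k a b → s a b ≠ 0
  mul : ∀ a b c, c ≤ b → b ≤ a → s b c * s a b = s a c
  mul_of_ne : ∀ a b c d, b ≠ c → s c d * s a b = 0
  sum_eq_one : ∑ a ∈ Finset.range n, s a a = 1
  mem_span : ∀ x, x ∈ Submodule.span K (Set.range fun p : ℕ × ℕ => s p.1 p.2)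

theorem IsChainSystem.op {K A : Type*} [Field K] [Ring A] [Algebra K A] {n k : ℕ}
    {r : ℕ → ℕ → A} (h : IsChainSystem K n k r) :
    IsLeftChainSystem K n k fun a b => MulOpposite.op (r a b) where
  eq_zero a b hab := by rw [h.eq_zero a b hab, MulOpposite.op_zero]
  ne_zero a b hab := by simpa using h.ne_zero a b hab
  mul a b c hcb hba := by rw [← MulOpposite.op_mul, h.mul a b c hcb hba]
  mul_of_ne a b c d hbc := by rw [← MulOpposite.op_mul, h.mul_of_ne a b c d hbc, MulOpposite.op_zero]
  sum_eq_one := by rw [← MulOpposite.op_one, ← h.sum_eq_one, Finset.op_sum]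
  mem_span x := by
    have := Submodule.mem_map_of_mem (f := (MulOpposite.opLinearEquiv K (M := A)).toLinearMap)
      (h.mem_span x.unop)
    rw [Submodule.map_span, ← Set.range_comp] at this
    exact this

theorem IsChainSystem.map {K A B : Type*} [Field K] [Ring A] [Algebra K A] [Ring B] [Algebra K B]
    {n k : ℕ} {r : ℕ → ℕ → A} (h : IsChainSystem K n k r) (e : A ≃ₐ[K] B) :
    IsChainSystem K n k fun a b => e (r a b) where
  eq_zero a b hab := by rw [h.eq_zero a b hab, map_zero]
  ne_zero a b hab := by simpa using h.ne_zero a b hab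
  mul a b c hcb hba := by rw [← map_mul, h.mul a b c hcb hba]
  mul_of_ne a b c d hbc := by rw [← map_mul, h.mul_of_ne a b c d hbc, map_zero]
  sum_eq_one := by rw [← map_one e, ← h.sum_eq_one, map_sum]
  mem_span x := by
    have := Submodule.mem_map_of_mem (f := e.toLinearMap) (h.mem_span (e.symm x))
    rw [Submodule.map_span, ← Set.range_comp] at this
    simpa [Function.comp_def] using this

/-! ### Paths in the linear quiver -/

namespace LinearA

variable {n : ℕ}

theorem val_of_hom {a b : LinearA n} (f : a ⟶ b) : Fin.val a = Fin.val b + 1 := by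
  have h : Fin.val a + 1 = Fin.val b + 1 + 1 := f.down
  omega

theorem val_le_of_path {a b : LinearA n} (p : Quiver.Path a b) : Fin.val b ≤ Fin.val a := by
  induction p with
  | nil => exact le_rfl
  | cons p f ih => have := val_of_hom f; omega

/-- Each vertex is the target of at most one arrow, so the last arrow of a path is forced and the
rest follows by induction. -/
theorem path_eq {a b : LinearA n} (p q : Quiver.Path a b) : p = q := by
  induction p with
  | nil =>
    cases q with
    | nil => rfl
    | cons q f => have := val_of_hom f; have := val_le_of_path q; omega
  | @cons c d p f ih =>
    cases q with
    | nil => have := val_of_hom f; have := val_le_of_path p; omega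
    | @cons c' _ q f' =>
      have h1 := val_of_hom f
      have h2 := val_of_hom f'
      obtain rfl : c = c' := Fin.ext (by omega)
      obtain rfl : f = f' := PLift.down_injective (Subsingleton.elim _ _)
      rw [ih q]

theorem nonempty_path {a b : LinearA n} (h : Fin.val b ≤ Fin.val a) :
    Nonempty (Quiver.Path a b) := by
  obtain ⟨d, hd⟩ := Nat.exists_eq_add_of_le h
  induction d generalizing b with
  | zero =>
    obtain rfl : a = b := Fin.ext (by omega)
    exact ⟨Quiver.Path.nil⟩
  | succ d ih =>
    have hlt : Fin.val b + 1 < n := by have := Fin.isLt a; omega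
    let c : LinearA n := (⟨Fin.val b + 1, hlt⟩ : Fin n)
    have hc : Fin.val c = Fin.val b + 1 := rfl
    obtain ⟨p⟩ := ih (b := c) (by omega) (by omega)
    exact ⟨p.cons ⟨congrArg (· + 1) hc⟩⟩

end LinearA

namespace PathAlgebra

variable {K : Type u} [Field K] {n : ℕ}

/-- The linear map from the path algebra that sends the path from `a` to `b` to `r a b`. -/
noncomputable def liftLinear {B : Type*} [AddCommGroup B] [Module K B] (r : ℕ → ℕ → B) :
    PathAlgebra K (LinearA n) →ₗ[K] B :=
  Finsupp.linearCombination K fun p : Σ a : LinearA n, Σ b : LinearA n, Quiver.Path a b =>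
    r (Fin.val p.1) (Fin.val p.2.1)

theorem liftLinear_ofPath {B : Type*} [AddCommGroup B] [Module K B] (r : ℕ → ℕ → B)
    {a b : LinearA n} (p : Quiver.Path a b) :
    liftLinear r (ofPath K p) = r (Fin.val a) (Fin.val b) :=
  (Finsupp.linearCombination_single K (1 : K) _).trans (one_smul K _)

/-- The coefficient of a path. -/
noncomputable def coeff {a b : LinearA n} (p : Quiver.Path a b) :
    PathAlgebra K (LinearA n) →ₗ[K] K :=
  Finsupp.lapply (⟨a, b, p⟩ : Σ a : LinearA n, Σ b : LinearA n, Quiver.Path a b)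

open Classical in
theorem coeff_ofPath {a b c d : LinearA n} (p : Quiver.Path a b) (q : Quiver.Path c d) :
    coeff p (ofPath K q) = if c = a ∧ d = b then 1 else 0 := by
  have h : coeff p (ofPath K q) = if (⟨c, d, q⟩ : Σ a : LinearA n, Σ b : LinearA n, Quiver.Path a b)
      = ⟨a, b, p⟩ then 1 else 0 := Finsupp.single_apply
  rw [h]
  refine if_congr ⟨fun h => ?_, ?_⟩ rfl rfl
  · cases h
    exact ⟨rfl, rfl⟩
  · rintro ⟨rfl, rfl⟩
    rw [LinearA.path_eq p q]

theorem eq_sum_coeff (x : PathAlgebra K (LinearA n)) :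
    ∃ s : Finset (Σ a : LinearA n, Σ b : LinearA n, Quiver.Path a b),
      x = ∑ p ∈ s, coeff p.2.2 x • ofPath K p.2.2 := by
  refine ⟨Finsupp.support x, (Finsupp.sum_single x).symm.trans ?_⟩
  refine Finset.sum_congr rfl fun p _ => ?_
  exact (Finsupp.smul_single_one p _).symm

theorem mem_of_ofPath_mem (S : Submodule K (PathAlgebra K (LinearA n)))
    (h : ∀ (a b : LinearA n) (p : Quiver.Path a b), ofPath K p ∈ S)
    (x : PathAlgebra K (LinearA n)) : x ∈ S := by
  obtain ⟨s, hs⟩ := eq_sum_coeff x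
  rw [hs]
  exact Submodule.sum_mem _ fun p _ => S.smul_mem _ (h _ _ _)

/-- The path from `a` to `b`, or zero if there is none. -/
noncomputable def pathElement (K : Type u) [Field K] (n a b : ℕ) : PathAlgebra K (LinearA n) :=
  if h : b ≤ a ∧ a < n then
    ofPath K (LinearA.nonempty_path (a := (⟨a, h.2⟩ : Fin n))
      (b := (⟨b, h.1.trans_lt h.2⟩ : Fin n)) h.1).some
  else 0

theorem ofPath_eq_pathElement {a b : LinearA n} (p : Quiver.Path a b) :
    ofPath K p = pathElement K n (Fin.val a) (Fin.val b) := by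
  rw [pathElement, dif_pos ⟨LinearA.val_le_of_path p, Fin.isLt a⟩]
  exact congrArg _ (LinearA.path_eq _ _)

theorem exists_pathElement_eq {a b : ℕ} (h : b ≤ a) (ha : a < n) :
    ∃ (a' b' : LinearA n) (p : Quiver.Path a' b'), Fin.val a' = a ∧ Fin.val b' = b ∧
      pathElement K n a b = ofPath K p :=
  ⟨(⟨a, ha⟩ : Fin n), (⟨b, h.trans_lt ha⟩ : Fin n), _, rfl, rfl, dif_pos ⟨h, ha⟩⟩

theorem isChainSystem (K : Type u) [Field K] (n : ℕ) :
    IsChainSystem K n 2 (pathElement K n) where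
  eq_zero a b h := dif_neg fun h' => h ⟨h'.1, h'.2, by omega⟩
  ne_zero a b h := by
    obtain ⟨a', b', p, -, -, hp⟩ := exists_pathElement_eq (K := K) h.1 h.2.1
    rw [hp]
    intro h0
    have := congrArg (coeff p) h0
    rw [coeff_ofPath, if_pos ⟨rfl, rfl⟩, map_zero] at this
    exact one_ne_zero this
  mul a b c hcb hba := by
    by_cases ha : a < n
    · obtain ⟨a', b', p, rfl, rfl, hp⟩ := exists_pathElement_eq (K := K) hba ha
      obtain ⟨b'', c', q, hb, rfl, hq⟩ := exists_pathElement_eq (K := K) hcb (hba.trans_lt ha)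
      obtain rfl : b'' = b' := Fin.ext hb
      rw [hp, hq, ofPath_mul_ofPath, ofPath_eq_pathElement]
    · have h0 : ∀ d, pathElement K n a d = 0 := fun d => dif_neg fun h => ha h.2
      rw [h0, h0, zero_mul]
  mul_of_ne a b c d hbc := by
    by_cases h1 : b ≤ a ∧ a < n
    · by_cases h2 : d ≤ c ∧ c < n
      · obtain ⟨a', b', p, rfl, rfl, hp⟩ := exists_pathElement_eq (K := K) h1.1 h1.2
        obtain ⟨c', d', q, rfl, rfl, hq⟩ := exists_pathElement_eq (K := K) h2.1 h2.2
        rw [hp, hq, ofPath_mul_ofPath_of_ne]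
        rintro rfl
        exact hbc rfl
      · rw [pathElement, pathElement, dif_neg h2, mul_zero]
    · rw [pathElement, dif_neg h1, zero_mul]
  sum_eq_one := by
    have h1 : (1 : PathAlgebra K (LinearA n)) =
        ∑ a : Fin n, ofPath K (Quiver.Path.nil : Quiver.Path (V := LinearA n) a a) := rfl
    rw [h1, Finset.sum_range]
    exact Finset.sum_congr rfl fun a _ => (ofPath_eq_pathElement _).symm
  mem_span := mem_of_ofPath_mem _ fun a b p => by
    rw [ofPath_eq_pathElement]
    exact Submodule.subset_span ⟨(Fin.val a, Fin.val b), rfl⟩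

end PathAlgebra

/-! ### Algebras with a chain system are isomorphic to `A(n, k)` -/

namespace IsChainSystem

open PathAlgebra

variable {K : Type u} {B : Type*} [Field K] [Ring B] [Algebra K B] {n k : ℕ} {r : ℕ → ℕ → B}
  (h : IsChainSystem K n k r)
include h

theorem liftLinear_one : liftLinear r (1 : PathAlgebra K (LinearA n)) = 1 := by
  rw [← (PathAlgebra.isChainSystem K n).sum_eq_one, map_sum, ← h.sum_eq_one]
  refine Finset.sum_congr rfl fun a ha => ?_
  obtain ⟨a', b', p, ha', hb', hp⟩ := exists_pathElement_eq (K := K) le_rfl (Finset.mem_range.1 ha)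
  rw [hp, liftLinear_ofPath, ha', hb']

theorem liftLinear_mul (x y : PathAlgebra K (LinearA n)) :
    liftLinear r (x * y) = liftLinear r x * liftLinear r y := by
  have key : (mulLinear K (V := LinearA n)).compr₂ (liftLinear r) =
      (LinearMap.mul K B).compl₁₂ (liftLinear r) (liftLinear r) := by
    refine linearMap_ext fun a b p => linearMap_ext fun c d q => ?_
    change liftLinear r (ofPath K p * ofPath K q) = liftLinear r (ofPath K p) * liftLinear r (ofPath K q)
    rw [liftLinear_ofPath, liftLinear_ofPath]
    by_cases hbc : b = c
    · subst hbc
      rw [ofPath_mul_ofPath, liftLinear_ofPath, h.mul _ _ _ (LinearA.val_le_of_path q) (LinearA.val_le_of_path p)]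
    · rw [ofPath_mul_ofPath_of_ne _ _ hbc, map_zero, h.mul_of_ne]
      exact fun h' => hbc (Fin.ext h')
  exact LinearMap.congr_fun (LinearMap.congr_fun key x) y

/-- The algebra homomorphism from the path algebra given by a chain system. -/
noncomputable def lift : PathAlgebra K (LinearA n) →ₐ[K] B :=
  AlgHom.ofLinearMap (liftLinear r) h.liftLinear_one h.liftLinear_mul

theorem lift_ofPath {a b : LinearA n} (p : Quiver.Path a b) :
    h.lift (ofPath K p) = r (Fin.val a) (Fin.val b) := liftLinear_ofPath r p

theorem lift_eq_zero_of_mem {x : PathAlgebra K (LinearA n)}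
    (hx : x ∈ (TwoSidedIdeal.span (zeroRelations K n k)).asIdeal) : h.lift x = 0 := by
  rw [TwoSidedIdeal.mem_asIdeal] at hx
  have hle : TwoSidedIdeal.span (zeroRelations K n k) ≤ TwoSidedIdeal.ker h.lift := by
    rw [TwoSidedIdeal.span_le]
    rintro _ ⟨a, b, c, β, α, hak, rfl⟩
    rw [SetLike.mem_coe, TwoSidedIdeal.mem_ker, ofPath_mul_ofPath, lift_ofPath]
    have h1 := LinearA.val_of_hom β
    have h2 := LinearA.val_of_hom α
    have h3 : Fin.val a + 1 ≤ k := hak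
    apply h.eq_zero
    rintro ⟨-, -, h4⟩
    omega
  exact (TwoSidedIdeal.mem_ker _).1 (hle hx)

/-- Multiplying by the idempotents at `a` and `b` isolates the coefficient of the only path between
them. This gives injectivity modulo the relations without a separate proof of linear independence.
-/
theorem lift_compress {a b : LinearA n} (p : Quiver.Path a b) (x : PathAlgebra K (LinearA n)) :
    r (Fin.val a) (Fin.val a) * h.lift x * r (Fin.val b) (Fin.val b) =
      coeff p x • r (Fin.val a) (Fin.val b) := by
  have key : ((LinearMap.mulLeft K (r (Fin.val a) (Fin.val a))).comp
      ((LinearMap.mulRight K (r (Fin.val b) (Fin.val b))).comp h.lift.toLinearMap)) =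
      (coeff p).smulRight (r (Fin.val a) (Fin.val b)) := by
    refine linearMap_ext fun c d q => ?_
    change r _ _ * (h.lift (ofPath K q) * r _ _) = coeff p (ofPath K q) • r _ _
    rw [lift_ofPath, coeff_ofPath, ← mul_assoc]
    by_cases hc : c = a
    · subst hc
      by_cases hd : d = b
      · subst hd
        rw [if_pos ⟨rfl, rfl⟩, one_smul, h.mul _ _ _ (LinearA.val_le_of_path p) le_rfl,
          h.mul _ _ _ le_rfl (LinearA.val_le_of_path p)]
      · rw [if_neg fun h' => hd h'.2, zero_smul, mul_assoc, h.mul_of_ne _ _ _ _ fun h' => hd (Fin.ext h'),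
          mul_zero]
    · rw [if_neg fun h' => hc h'.1, zero_smul, h.mul_of_ne _ _ _ _ fun h' => hc (Fin.ext h').symm,
        zero_mul]
  rw [mul_assoc]
  exact LinearMap.congr_fun key x

end IsChainSystem

/-- A path that is not good has length at least two and ends at some `b` with `b + 3 ≤ k`, so its
last two arrows `b + 2 → b + 1 → b` already form a relation. -/
theorem pathElement_mem_zeroRelations {K : Type u} [Field K] {n k a b : ℕ}
    (hba : b ≤ a) (han : a < n) (hab : ¬ GoodPair n k a b) :
    PathAlgebra.pathElement K n a b ∈ TwoSidedIdeal.span (zeroRelations K n k) := by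
  have h1 : ¬ (a ≤ b + 1) := fun h => hab ⟨hba, han, Or.inl h⟩
  have h2 : ¬ (k ≤ a ∧ k ≤ b + 2) := fun h => hab ⟨hba, han, Or.inr h⟩
  have hC := PathAlgebra.isChainSystem K n
  rw [← hC.mul a (b + 2) b (by omega) (by omega)]
  refine TwoSidedIdeal.mul_mem_left _ _ _ (TwoSidedIdeal.subset_span ?_)
  let b0 : LinearA n := (⟨b, by omega⟩ : Fin n)
  let b1 : LinearA n := (⟨b + 1, by omega⟩ : Fin n)
  let b2 : LinearA n := (⟨b + 2, by omega⟩ : Fin n)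
  let f : b2 ⟶ b1 := ⟨rfl⟩
  let g : b1 ⟶ b0 := ⟨rfl⟩
  refine ⟨b2, b1, b0, f, g, ?_, ?_⟩
  · change b + 2 + 1 ≤ k
    omega
  · rw [PathAlgebra.ofPath_mul_ofPath, PathAlgebra.ofPath_eq_pathElement]

namespace IsChainSystem

open PathAlgebra

variable {K : Type u} {B : Type*} [Field K] [Ring B] [Algebra K B] {n k : ℕ} {r : ℕ → ℕ → B}
  (h : IsChainSystem K n k r)
include h

/-- By `lift_compress`, only paths that are not good can have a nonzero coefficient, and these paths
lie in the ideal. -/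
theorem mem_of_lift_eq_zero {x : PathAlgebra K (LinearA n)} (hx : h.lift x = 0) :
    x ∈ (TwoSidedIdeal.span (zeroRelations K n k)).asIdeal := by
  obtain ⟨s, hs⟩ := eq_sum_coeff x
  rw [hs]
  refine Submodule.sum_mem _ fun p _ => ?_
  by_cases hp : GoodPair n k (Fin.val p.1) (Fin.val p.2.1)
  · have := h.lift_compress p.2.2 x
    rw [hx, mul_zero, zero_mul] at this
    rw [(smul_eq_zero.1 this.symm).resolve_right (h.ne_zero _ _ hp), zero_smul]
    exact Submodule.zero_mem _
  · rw [Algebra.smul_def]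
    refine Ideal.mul_mem_left _ _ (TwoSidedIdeal.mem_asIdeal.2 ?_)
    rw [ofPath_eq_pathElement]
    exact pathElement_mem_zeroRelations (LinearA.val_le_of_path p.2.2) (Fin.isLt p.1) hp

theorem lift_surjective : Function.Surjective h.lift := by
  intro x
  have hle : Submodule.span K (Set.range fun p : ℕ × ℕ => r p.1 p.2) ≤
      LinearMap.range h.lift.toLinearMap := by
    rw [Submodule.span_le]
    rintro _ ⟨⟨a, b⟩, rfl⟩
    by_cases hab : GoodPair n k a b
    · obtain ⟨a', b', p, rfl, rfl, -⟩ := exists_pathElement_eq (K := K) hab.1 hab.2.1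
      exact ⟨ofPath K p, h.lift_ofPath p⟩
    · exact ⟨0, by simp [h.eq_zero a b hab]⟩
  exact hle (h.mem_span x)

/-- An algebra with a chain system is isomorphic to `A(n, k)`. -/
noncomputable def boundAlgebraEquiv : BoundAlgebra K n k ≃ₐ[K] B :=
  AlgEquiv.ofBijective (Ideal.Quotient.liftₐ _ h.lift fun _ hx => h.lift_eq_zero_of_mem hx) <| by
    constructor
    · rw [injective_iff_map_eq_zero]
      intro x hx
      obtain ⟨y, rfl⟩ := Ideal.Quotient.mk_surjective x
      exact Ideal.Quotient.eq_zero_iff_mem.2 (h.mem_of_lift_eq_zero hx)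
    · intro b
      obtain ⟨y, rfl⟩ := h.lift_surjective b
      exact ⟨Ideal.Quotient.mk _ y, rfl⟩

end IsChainSystem

/-! ### Cyclic modules over algebras with a chain system -/

namespace IsLeftChainSystem

variable {K R : Type*} [Field K] [Ring R] [Algebra K R] {n k : ℕ} {s : ℕ → ℕ → R}
  (h : IsLeftChainSystem K n k s)
include h

theorem mul_left_idem (a b : ℕ) : s b b * s a b = s a b := by
  by_cases hba : b ≤ a
  · exact h.mul a b b le_rfl hba
  · rw [h.eq_zero a b fun hab => hba hab.1, mul_zero]

theorem mul_right_idem (a b : ℕ) : s a b * s a a = s a b := by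
  by_cases hba : b ≤ a
  · exact h.mul a a b hba le_rfl
  · rw [h.eq_zero a b fun hab => hba hab.1, zero_mul]

theorem eq_zero_of_lt {a b : ℕ} (hab : a < b) : s a b = 0 :=
  h.eq_zero a b fun h' => absurd h'.1 (by omega)

/-- The component between two vertices is at most one-dimensional. All later descriptions of
elements and homomorphisms by a single scalar rest on this. -/
theorem exists_mul_mul_eq_smul (x : R) (a b : ℕ) : ∃ κ : K, s b b * x * s a a = κ • s a b := by
  induction h.mem_span x using Submodule.span_induction with
  | mem x hx =>
    obtain ⟨⟨c, d⟩, rfl⟩ := hx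
    change ∃ κ : K, s b b * s c d * s a a = κ • s a b
    by_cases hd : d = b
    · subst hd
      by_cases hc : a = c
      · subst hc
        exact ⟨1, by rw [h.mul_left_idem, h.mul_right_idem, one_smul]⟩
      · exact ⟨0, by rw [mul_assoc, h.mul_of_ne _ _ _ _ hc, mul_zero, zero_smul]⟩
    · exact ⟨0, by rw [h.mul_of_ne _ _ _ _ hd, zero_mul, zero_smul]⟩
  | zero => exact ⟨0, by simp⟩
  | add x y _ _ hx hy =>
    obtain ⟨κ, hκ⟩ := hx
    obtain ⟨μ, hμ⟩ := hy
    exact ⟨κ + μ, by rw [mul_add, add_mul, hκ, hμ, add_smul]⟩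
  | smul c x _ hx =>
    obtain ⟨κ, hκ⟩ := hx
    exact ⟨c * κ, by rw [mul_smul_comm, smul_mul_assoc, hκ, smul_smul]⟩

/-! ### Modules decomposed by vertices -/

section Module

variable {M : Type*} [AddCommGroup M] [Module R M]

theorem sum_smul (m : M) : ∑ a ∈ Finset.range n, s a a • m = m := by
  rw [← Finset.sum_smul, h.sum_eq_one, one_smul]

theorem ext_smul {m m' : M} (hm : ∀ a, s a a • m = s a a • m') : m = m' := by
  rw [← h.sum_smul m, ← h.sum_smul m']
  exact Finset.sum_congr rfl fun a _ => hm a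

theorem idem_smul (a b : ℕ) (m : M) : s b b • s a b • m = s a b • m := by
  rw [smul_smul, h.mul_left_idem]

theorem smul_idem (a b : ℕ) (m : M) : s a b • s a a • m = s a b • m := by
  rw [smul_smul, h.mul_right_idem]

theorem smul_smul_of_le {a b c : ℕ} (hcb : c ≤ b) (hba : b ≤ a) (m : M) :
    s b c • s a b • m = s a c • m := by
  rw [smul_smul, h.mul a b c hcb hba]

theorem smul_smul_of_ne {a b c d : ℕ} (hbc : b ≠ c) (m : M) : s c d • s a b • m = 0 := by
  rw [smul_smul, h.mul_of_ne a b c d hbc, zero_smul]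

theorem smul_eq_zero_of_ne {a c d : ℕ} {m : M} (hm : s a a • m = m) (hac : a ≠ c) :
    s c d • m = 0 := by
  rw [← hm, h.smul_smul_of_ne hac]

theorem exists_idem_smul_smul_eq {a : ℕ} {m : M} (hm : s a a • m = m) (x : R) (b : ℕ) :
    ∃ κ : K, s b b • x • m = (κ • s a b) • m := by
  obtain ⟨κ, hκ⟩ := h.exists_mul_mul_eq_smul x a b
  exact ⟨κ, by rw [← hκ, mul_smul, mul_smul, hm]⟩

/-- An additive subgroup is used because `M` carries no `K`-structure of its own; scalars act only
through `R`. -/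
theorem mem_of_forall_smul_mem {P : AddSubgroup M}
    (hP : ∀ (κ : K) (a b : ℕ) (m : M), m ∈ P → (κ • s a b) • m ∈ P) (x : R) {m : M} (hm : m ∈ P) :
    x • m ∈ P := by
  have : ∀ κ : K, (κ • x) • m ∈ P := by
    induction h.mem_span x using Submodule.span_induction with
    | mem x hx =>
      obtain ⟨⟨c, d⟩, rfl⟩ := hx
      exact fun κ => hP κ c d m hm
    | zero => intro κ; rw [smul_zero, zero_smul]; exact P.zero_mem
    | add x y _ _ hx hy => intro κ; rw [smul_add, add_smul]; exact P.add_mem (hx κ) (hy κ)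
    | smul c x _ hx => intro κ; rw [smul_smul]; exact hx _
  simpa using this 1

end Module

/-- The left ideal that defines `cyclic h t l`. -/
def annihilator (t l : ℕ) : Submodule R R where
  carrier := {x | ∀ c, l ≤ c → s c c * x * s t t = 0}
  zero_mem' := by simp
  add_mem' := by
    intro x y hx hy c hc
    rw [mul_add, add_mul, hx c hc, hy c hc, add_zero]
  smul_mem' := by
    intro y x hx c hc
    -- Insert `1` as the sum of the idempotents at `d`. Paths only descend, so a component at `d <
    -- l` cannot contribute at `c ≥ l`.
    have h1 : s c c * (y • x) * s t t =
        ∑ d ∈ Finset.range n, (s c c * y * s d d) * (s d d * x * s t t) := by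
      have h2 : ∀ d, (s c c * y * s d d) * (s d d * x * s t t) =
          s c c * y * s d d * (x * s t t) := fun d => by
        rw [mul_assoc (s d d), mul_assoc _ (s d d), ← mul_assoc (s d d), h.mul d d d le_rfl le_rfl,
          ← mul_assoc]
      simp_rw [h2]
      rw [← Finset.sum_mul, ← Finset.mul_sum, h.sum_eq_one, mul_one, smul_eq_mul]
      simp only [mul_assoc]
    rw [h1]
    refine Finset.sum_eq_zero fun d _ => ?_
    by_cases hd : l ≤ d
    · rw [hx d hd, mul_zero]
    · obtain ⟨κ, hκ⟩ := h.exists_mul_mul_eq_smul y d c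
      rw [hκ, h.eq_zero_of_lt (by omega), smul_zero, zero_mul]

theorem mem_annihilator {t l : ℕ} {x : R} :
    x ∈ h.annihilator t l ↔ ∀ c, l ≤ c → s c c * x * s t t = 0 := Iff.rfl

/-- The quotient of the indecomposable projective module at `t` by its elements that live at the
vertices below `l`. -/
abbrev Cyclic (t l : ℕ) : Type _ := R ⧸ h.annihilator t l

/-- The canonical generator. -/
def gen (t l : ℕ) : h.Cyclic t l := (h.annihilator t l).mkQ 1

theorem smul_gen_eq_mk (t l : ℕ) (x : R) : x • h.gen t l = (h.annihilator t l).mkQ x := by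
  rw [gen, ← map_smul, smul_eq_mul, mul_one]

theorem exists_eq_smul_gen {t l : ℕ} (y : h.Cyclic t l) : ∃ x : R, y = x • h.gen t l := by
  obtain ⟨x, rfl⟩ := (h.annihilator t l).mkQ_surjective y
  exact ⟨x, (h.smul_gen_eq_mk t l x).symm⟩

theorem smul_gen_eq_zero_iff {t l : ℕ} {x : R} :
    x • h.gen t l = 0 ↔ ∀ c, l ≤ c → s c c * x * s t t = 0 := by
  rw [h.smul_gen_eq_mk, Submodule.mkQ_apply, Submodule.Quotient.mk_eq_zero, h.mem_annihilator]

theorem idem_smul_gen (t l : ℕ) : s t t • h.gen t l = h.gen t l := by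
  rw [← sub_eq_zero]
  nth_rw 2 [← one_smul R (h.gen t l)]
  rw [← sub_smul, h.smul_gen_eq_zero_iff]
  intro c _
  rw [mul_assoc, sub_mul, one_mul, h.mul_left_idem, sub_self, mul_zero]

theorem smul_gen_eq_zero_of_lt {t l c : ℕ} (hc : c < l) : s t c • h.gen t l = 0 := by
  rw [h.smul_gen_eq_zero_iff]
  intro d hd
  rw [h.mul_of_ne _ _ _ _ (by omega), zero_mul]

/-- The nonzero paths from `t` to vertices at least `l` act on the generator like a basis. With
`exists_idem_smul_eq`, questions about maps of cyclic modules become conditions on pairs of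
vertices. -/
theorem smul_smul_gen_eq_zero_iff {t l c : ℕ} {κ : K} :
    (κ • s t c) • h.gen t l = 0 ↔ κ = 0 ∨ c < l ∨ ¬ GoodPair n k t c := by
  constructor
  · intro h0
    by_contra! hc
    have := h.smul_gen_eq_zero_iff.1 h0 c hc.2.1
    rw [mul_smul_comm, smul_mul_assoc, h.mul_left_idem, h.mul_right_idem] at this
    exact (smul_eq_zero.1 this).elim hc.1 (h.ne_zero t c hc.2.2)
  · rintro (rfl | hc | hc)
    · rw [zero_smul, zero_smul]
    · rw [smul_assoc, h.smul_gen_eq_zero_of_lt hc, smul_zero]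
    · rw [h.eq_zero _ _ hc, smul_zero, zero_smul]

theorem smul_gen_eq_zero_iff_of_path {t l c : ℕ} :
    s t c • h.gen t l = 0 ↔ c < l ∨ ¬ GoodPair n k t c := by
  have := h.smul_smul_gen_eq_zero_iff (t := t) (l := l) (c := c) (κ := 1)
  rw [one_smul] at this
  rw [this, or_iff_right one_ne_zero]

theorem exists_idem_smul_eq {t l : ℕ} (y : h.Cyclic t l) (c : ℕ) :
    ∃ κ : K, s c c • y = (κ • s t c) • h.gen t l := by
  obtain ⟨x, rfl⟩ := h.exists_eq_smul_gen y
  exact h.exists_idem_smul_smul_eq (h.idem_smul_gen t l) x c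

section Lift

variable {M : Type*} [AddCommGroup M] [Module R M]

open Classical in
/-- The homomorphism from a cyclic module that sends the generator to `m`; it is zero if
there is no such homomorphism. -/
noncomputable def cyclicLift (t l : ℕ) (m : M) : h.Cyclic t l →ₗ[R] M :=
  if hm : h.annihilator t l ≤ LinearMap.ker (LinearMap.toSpanSingleton R M m) then
    (h.annihilator t l).liftQ _ hm
  else 0

/-- The defining left ideal is handled one vertex at a time: components at `c ≥ l` kill `m` by
definition of the ideal, and those at `c < l` are multiples of the path `t → c`, which kills `m` by
`hl`. -/
theorem cyclicLift_gen {t l : ℕ} {m : M} (hm : s t t • m = m) (hl : ∀ c < l, s t c • m = 0) :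
    h.cyclicLift t l m (h.gen t l) = m := by
  have hle : h.annihilator t l ≤ LinearMap.ker (LinearMap.toSpanSingleton R M m) := by
    intro x hx
    rw [LinearMap.mem_ker, LinearMap.toSpanSingleton_apply]
    refine h.ext_smul fun c => ?_
    rw [smul_zero]
    by_cases hc : l ≤ c
    · rw [← hm, smul_smul, smul_smul, hx c hc, zero_smul]
    · obtain ⟨κ, hκ⟩ := h.exists_idem_smul_smul_eq hm x c
      rw [hκ, algebra_compatible_smul R κ, smul_eq_mul, mul_smul, hl c (by omega), smul_zero]
  rw [cyclicLift, dif_pos hle, gen, Submodule.mkQ_apply, Submodule.liftQ_apply,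
    LinearMap.toSpanSingleton_apply, one_smul]

theorem hom_ext {t l : ℕ} {f g : h.Cyclic t l →ₗ[R] M}
    (hfg : f (h.gen t l) = g (h.gen t l)) : f = g := by
  ext
  change f (h.gen t l) = g (h.gen t l)
  exact hfg

theorem idem_smul_map_gen {t l : ℕ} (f : h.Cyclic t l →ₗ[R] M) :
    s t t • f (h.gen t l) = f (h.gen t l) := by
  rw [← map_smul, h.idem_smul_gen]

end Lift

/-- With cut `0` the module is `R e_t`: sending the generator to the idempotent splits the quotient
map. -/
theorem projective_cyclic (t : ℕ) : Module.Projective R (h.Cyclic t 0) := by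
  refine Module.Projective.of_split (h.cyclicLift t 0 (s t t)) (h.annihilator t 0).mkQ
    (h.hom_ext ?_)
  rw [LinearMap.comp_apply, h.cyclicLift_gen (h.mul_left_idem t t) (by simp), ← h.smul_gen_eq_mk,
    h.idem_smul_gen, LinearMap.id_apply]

/-! ### Short exact sequences of cyclic modules -/

/-- `hzero` makes the map well defined on the generator; `hgood` says that each basis path of the
source stays nonzero after prepending `t → q`. -/
theorem cyclicLift_injective {q t l l' : ℕ} (hqt : q ≤ t)
    (hzero : ∀ c < l', c ≤ q → c < l ∨ ¬ GoodPair n k t c)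
    (hgood : ∀ c, l' ≤ c → GoodPair n k q c → l ≤ c ∧ GoodPair n k t c) :
    Function.Injective (h.cyclicLift q l' (s t q • h.gen t l)) := by
  rw [injective_iff_map_eq_zero]
  intro y hy
  have hgen : h.cyclicLift q l' (s t q • h.gen t l) (h.gen q l') = s t q • h.gen t l := by
    refine h.cyclicLift_gen (h.idem_smul _ _ _) fun c hc => ?_
    by_cases hcq : c ≤ q
    · rw [h.smul_smul_of_le hcq hqt]
      exact h.smul_gen_eq_zero_iff_of_path.2 (hzero c hc hcq)
    · rw [h.eq_zero_of_lt (by omega), zero_smul]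
  refine h.ext_smul fun c => ?_
  obtain ⟨κ, hκ⟩ := h.exists_idem_smul_eq y c
  have h1 : (κ • s q c) • s t q • h.gen t l = 0 := by
    rw [← hgen, ← map_smul, ← hκ, map_smul, hy, smul_zero]
  rw [hκ, smul_zero, h.smul_smul_gen_eq_zero_iff]
  by_contra! hc
  rw [smul_smul, smul_mul_assoc, h.mul t q c hc.2.2.1 hqt, h.smul_smul_gen_eq_zero_iff] at h1
  have := hgood c hc.2.1 hc.2.2
  obtain h1 | h1 | h1 := h1
  · exact hc.1 h1
  · omega
  · exact h1 this.2

theorem cyclicLift_gen_of_le {t l l' : ℕ} (hl : l' ≤ l) :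
    h.cyclicLift t l' (h.gen t l) (h.gen t l') = h.gen t l :=
  h.cyclicLift_gen (h.idem_smul_gen t l) fun _ hc => h.smul_gen_eq_zero_of_lt (by omega)

theorem cyclicLift_surjective {t l l' : ℕ} (hl : l' ≤ l) :
    Function.Surjective (h.cyclicLift t l' (h.gen t l)) := by
  intro y
  obtain ⟨x, rfl⟩ := h.exists_eq_smul_gen y
  exact ⟨x • h.gen t l', by rw [map_smul, h.cyclicLift_gen_of_le hl]⟩

/-- The kernel of `P_t → Cyclic t l` is spanned by the nonzero paths from `t` to vertices below `l`;
by `hle` these pass through `q`, hence come from the generator of the left-hand module. `hql` makes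
the composite zero. -/
theorem cyclicLift_exact {q t l l' : ℕ} (hqt : q ≤ t)
    (hzero : ∀ c < l', c ≤ q → ¬ GoodPair n k t c) (hql : q < l ∨ ¬ GoodPair n k t q)
    (hle : ∀ c < l, GoodPair n k t c → c ≤ q) :
    Function.Exact (h.cyclicLift q l' (s t q • h.gen t 0)) (h.cyclicLift t 0 (h.gen t l)) := by
  have hgen : h.cyclicLift q l' (s t q • h.gen t 0) (h.gen q l') = s t q • h.gen t 0 := by
    refine h.cyclicLift_gen (h.idem_smul _ _ _) fun c hc => ?_
    by_cases hcq : c ≤ q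
    · rw [h.smul_smul_of_le hcq hqt]
      exact h.smul_gen_eq_zero_iff_of_path.2 (Or.inr (hzero c hc hcq))
    · rw [h.eq_zero_of_lt (by omega), zero_smul]
  have hgen' := h.cyclicLift_gen_of_le (t := t) (Nat.zero_le l)
  intro y
  constructor
  · intro hy
    change y ∈ LinearMap.range (h.cyclicLift q l' (s t q • h.gen t 0))
    rw [← h.sum_smul y]
    refine Submodule.sum_mem _ fun c _ => ?_
    obtain ⟨κ, hκ⟩ := h.exists_idem_smul_eq y c
    rw [hκ]
    by_cases hc : GoodPair n k t c
    · by_cases hcl : c < l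
      · refine ⟨(κ • s q c) • h.gen q l', ?_⟩
        rw [map_smul, hgen, smul_smul, smul_mul_assoc, h.mul t q c (hle c hcl hc) hqt]
      · have h1 : (κ • s t c) • h.gen t l = 0 := by
          rw [← hgen', ← map_smul, ← hκ, map_smul, hy, smul_zero]
        rw [h.smul_smul_gen_eq_zero_iff] at h1
        rw [h1.resolve_right (by tauto), zero_smul, zero_smul]
        exact Submodule.zero_mem _
    · rw [h.eq_zero _ _ hc, smul_zero, zero_smul]
      exact Submodule.zero_mem _
  · rintro ⟨z, rfl⟩
    obtain ⟨x, rfl⟩ := h.exists_eq_smul_gen z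
    rw [map_smul, hgen, map_smul, map_smul, hgen', h.smul_gen_eq_zero_iff_of_path.2 hql, smul_zero]

end IsLeftChainSystem

/-! ### The global dimension -/

/-! ### Short exact sequences and arbitrary direct sums -/

theorem shortExact_of_linearMap {R : Type u} [Ring R] {X Y Z : Type u} [AddCommGroup X] [Module R X]
    [AddCommGroup Y] [Module R Y] [AddCommGroup Z] [Module R Z] {f : X →ₗ[R] Y} {g : Y →ₗ[R] Z}
    (hf : Function.Injective f) (hfg : Function.Exact f g) (hg : Function.Surjective g) :
    (ModuleCat.shortComplexOfCompEqZero f g hfg.linearMap_comp_eq_zero).ShortExact :=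
  ModuleCat.shortComplex_shortExact _ hfg hf hg

theorem exact_finsuppMapRange {R X Y Z : Type*} [Ring R] [AddCommGroup X] [Module R X]
    [AddCommGroup Y] [Module R Y] [AddCommGroup Z] [Module R Z] {f : X →ₗ[R] Y} {g : Y →ₗ[R] Z}
    (hfg : Function.Exact f g) (ι : Type*) :
    Function.Exact (Finsupp.mapRange.linearMap (α := ι) f)
      (Finsupp.mapRange.linearMap (α := ι) g) := by
  classical
  intro y
  constructor
  · intro hy
    have hy' : ∀ i, ∃ x, f x = y i := fun i => (hfg (y i)).1 (DFunLike.congr_fun hy i)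
    choose x hx using hy'
    refine ⟨Finsupp.onFinset y.support (fun i => if y i = 0 then 0 else x i) fun i hi => ?_, ?_⟩
    · rw [Finsupp.mem_support_iff]
      exact fun h => hi (if_pos h)
    · ext i
      rw [Finsupp.mapRange.linearMap_apply, Finsupp.mapRange_apply, Finsupp.onFinset_apply]
      split_ifs with h
      · rw [map_zero, h]
      · exact hx i
  · rintro ⟨x, rfl⟩
    ext i
    exact (hfg _).2 ⟨x i, rfl⟩

theorem projective_finsupp {R X : Type*} [Ring R] [AddCommGroup X] [Module R X]
    [Module.Projective R X] (ι : Type*) : Module.Projective R (ι →₀ X) := by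
  classical
  exact Module.Projective.of_equiv (finsuppLequivDFinsupp R).symm

namespace IsLeftChainSystem

section Isotypic

variable {K R : Type*} [Field K] [Ring R] [Algebra K R] {n k : ℕ} {s : ℕ → ℕ → R}
  (h : IsLeftChainSystem K n k s)
include h

theorem exists_eq_smul_gen_simple {j : ℕ} (y : h.Cyclic j j) :
    ∃ κ : K, y = (κ • s j j) • h.gen j j := by
  obtain ⟨κ, hκ⟩ := h.exists_idem_smul_eq y j
  refine ⟨κ, hκ ▸ h.ext_smul fun c => ?_⟩
  by_cases hc : c = j
  · rw [hc, h.idem_smul]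
  · rw [h.smul_smul_of_ne fun h' => hc h'.symm]
    obtain ⟨μ, hμ⟩ := h.exists_idem_smul_eq y c
    rw [hμ, h.smul_smul_gen_eq_zero_iff]
    right
    by_cases hcj : c < j
    · exact Or.inl hcj
    · exact Or.inr fun h' => by have := h'.1; omega

/-- A module all of whose composition factors are the simple module at `j`, and on which the
arrows act trivially, is a direct sum of copies of this simple module. -/
theorem exists_equiv_finsupp_simple {j : ℕ} {M : Type u} [AddCommGroup M] [Module R M]
    (hM : ∀ a b, ¬ (a = j ∧ b = j) → ∀ m : M, s a b • m = 0) :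
    ∃ ι : Type u, Nonempty ((ι →₀ h.Cyclic j j) ≃ₗ[R] M) := by
  let _ : Module K M := Module.compHom M (algebraMap K R)
  let b := Module.Basis.ofVectorSpace K M
  have hj : ∀ m : M, s j j • m = m := fun m => h.ext_smul fun a => by
    by_cases ha : a = j
    · rw [ha, h.idem_smul]
    · rw [hM a a fun h' => ha h'.1, hM a a fun h' => ha h'.1]
  have hgen : ∀ m : M, h.cyclicLift j j m (h.gen j j) = m := fun m =>
    h.cyclicLift_gen (hj m) fun c hc => hM _ _ (by omega) m
  have hK : ∀ (κ : K) (m : M), (κ • s j j) • m = κ • m := fun κ m => by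
    rw [algebra_compatible_smul R κ, smul_eq_mul, mul_smul, hj]
    rfl
  let F : (Module.Basis.ofVectorSpaceIndex K M →₀ h.Cyclic j j) →ₗ[R] M :=
    Finsupp.lsum ℕ fun i => h.cyclicLift j j (b i)
  refine ⟨_, ⟨LinearEquiv.ofBijective F ⟨?_, ?_⟩⟩⟩
  · rw [injective_iff_map_eq_zero]
    intro y hy
    choose κ hκ using fun i => h.exists_eq_smul_gen_simple (y i)
    have h1 : ∑ i ∈ y.support, κ i • b i = 0 := by
      rw [← hy, Finsupp.lsum_apply, Finsupp.sum]
      refine Finset.sum_congr rfl fun i _ => ?_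
      rw [hκ i, map_smul, hgen, hK]
    ext1 i
    rw [Finsupp.zero_apply]
    by_contra hi
    have := linearIndependent_iff'.1 b.linearIndependent _ κ h1 i (Finsupp.mem_support_iff.2 hi)
    rw [hκ i, this, zero_smul, zero_smul] at hi
    exact hi rfl
  · intro m
    induction b.mem_span m using Submodule.span_induction with
    | mem x hx =>
      obtain ⟨i, rfl⟩ := hx
      exact ⟨Finsupp.single i (h.gen j j), by rw [Finsupp.lsum_single, hgen]⟩
    | zero => exact ⟨0, map_zero F⟩
    | add x y _ _ hx hy =>
      obtain ⟨x', rfl⟩ := hx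
      obtain ⟨y', rfl⟩ := hy
      exact ⟨x' + y', map_add F _ _⟩
    | smul c x _ hx =>
      obtain ⟨x', rfl⟩ := hx
      exact ⟨algebraMap K R c • x', map_smul F _ _⟩

/-- The elements that vanish at `j`, if `j` is the largest vertex at which the module lives. -/
def vanishingSubmodule {j : ℕ} {M : Type*} [AddCommGroup M] [Module R M]
    (hM : ∀ a, j < a → ∀ m : M, s a a • m = 0) : Submodule R M where
  carrier := {m | s j j • m = 0}
  zero_mem' := smul_zero _
  add_mem' {x y} hx hy := by
    change s j j • (x + y) = 0
    rw [smul_add, show s j j • x = 0 from hx, show s j j • y = 0 from hy, add_zero]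
  smul_mem' x m hm := by
    refine h.mem_of_forall_smul_mem (P := (DistribSMul.toAddMonoidHom M (s j j)).ker) ?_ x hm
    intro κ a b m hm
    change s j j • m = 0 at hm
    change s j j • (κ • s a b) • m = 0
    rw [algebra_compatible_smul R κ, smul_eq_mul, mul_smul, smul_smul, ← Algebra.commutes, mul_smul]
    refine (congrArg _ ?_).trans (smul_zero _)
    by_cases hb : b = j
    · subst hb
      rw [h.idem_smul, ← h.smul_idem]
      rcases lt_trichotomy a b with ha | ha | ha
      · rw [h.eq_zero_of_lt ha, zero_smul]
      · rw [ha, hm, smul_zero]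
      · rw [hM a ha, smul_zero]
    · exact h.smul_smul_of_ne hb m

theorem mem_vanishingSubmodule {j : ℕ} {M : Type*} [AddCommGroup M] [Module R M]
    (hM : ∀ a, j < a → ∀ m : M, s a a • m = 0) {m : M} :
    m ∈ h.vanishingSubmodule hM ↔ s j j • m = 0 := Iff.rfl

end Isotypic

/-! ### Projective dimensions of the simple modules and of arbitrary modules -/

variable {K R : Type u} [Field K] [Ring R] [Algebra K R] {n k : ℕ} {s : ℕ → ℕ → R}
  (h : IsLeftChainSystem K n k s)
include h

/-- For `j + 1 < k` the only nonzero paths from `j + 1` end at `j + 1` and `j`, whence `0 → S_j →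
P_{j+1} → S_{j+1} → 0`. Arbitrary direct sums are needed because the modules are not assumed
finitely generated. -/
theorem hasProjectiveDimensionLT_finsupp_simple_of_lt (ι : Type u) {j : ℕ} (hjk : j < k)
    (hjn : j < n) :
    HasProjectiveDimensionLT (ModuleCat.of R (ι →₀ h.Cyclic j j)) (j + 1) := by
  induction j with
  | zero =>
    have := h.projective_cyclic 0
    have := (IsProjective.iff_projective (R := R) (ι →₀ h.Cyclic 0 0)).1 (projective_finsupp ι)
    infer_instance
  | succ j ih =>
    have hinj := h.cyclicLift_injective (q := j) (t := j + 1) (l := 0) (l' := j) (by omega)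
      (fun c _ _ => Or.inr fun h' => by have := h'.2.2; omega)
      (fun c _ h' => ⟨by omega, by have := h'.1; exact ⟨by omega, hjn, by omega⟩⟩)
    have hex := h.cyclicLift_exact (q := j) (t := j + 1) (l := j + 1) (l' := j) (by omega)
      (fun c _ _ h' => by have := h'.2.2; omega) (by omega) (fun c _ _ => by omega)
    have hsurj := h.cyclicLift_surjective (t := j + 1) (Nat.zero_le (j + 1))
    have hS := shortExact_of_linearMap (Finsupp.mapRange_injective _ (map_zero _) hinj)
      (exact_finsuppMapRange hex ι) (Finsupp.mapRange_surjective _ (map_zero _) hsurj)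
    have := h.projective_cyclic (j + 1)
    have hP := (IsProjective.iff_projective (R := R) (ι →₀ h.Cyclic (j + 1) 0)).1 (projective_finsupp ι)
    exact (hS.hasProjectiveDimensionLT_X₃_iff j hP).2 (ih (by omega) (by omega))

/-- For `j ≥ k` every nonzero path from `j - 1` stays nonzero after prepending the arrow from `j`,
whence `0 → P_{j-1} → P_j → S_j → 0`. -/
theorem hasProjectiveDimensionLT_finsupp_simple_of_ge (ι : Type u) {j : ℕ} (hk : 2 ≤ k) (hjk : k ≤ j)
    (hjn : j < n) :
    HasProjectiveDimensionLT (ModuleCat.of R (ι →₀ h.Cyclic j j)) 2 := by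
  have hinj := h.cyclicLift_injective (q := j - 1) (t := j) (l := 0) (l' := 0) (by omega)
    (fun c _ _ => by omega)
    (fun c _ h' => ⟨by omega, by have := h'.1; have := h'.2.2; exact ⟨by omega, hjn, by omega⟩⟩)
  have hex := h.cyclicLift_exact (q := j - 1) (t := j) (l := j) (l' := 0) (by omega)
    (fun c _ _ h' => by omega) (by omega) (fun c _ _ => by omega)
  have hsurj := h.cyclicLift_surjective (t := j) (Nat.zero_le j)
  have hS := shortExact_of_linearMap (Finsupp.mapRange_injective _ (map_zero _) hinj)
    (exact_finsuppMapRange hex ι) (Finsupp.mapRange_surjective _ (map_zero _) hsurj)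
  have := h.projective_cyclic j
  have := h.projective_cyclic (j - 1)
  have hP := (IsProjective.iff_projective (R := R) (ι →₀ h.Cyclic j 0)).1 (projective_finsupp ι)
  have hQ := (IsProjective.iff_projective (R := R) (ι →₀ h.Cyclic (j - 1) 0)).1 (projective_finsupp ι)
  exact (hS.hasProjectiveDimensionLT_X₃_iff 0 hP).2 (projective_iff_hasProjectiveDimensionLT_one.1 hQ)

/-- Induction on the number of vertices at which `M` may live: split off its top vertex as a
quotient that is a sum of copies of one simple module. -/
theorem hasProjectiveDimensionLT_of_vanishing (hk : 2 ≤ k) {j : ℕ} (hj : j ≤ n) (M : Type u)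
    [AddCommGroup M] [Module R M] (hM : ∀ a, j ≤ a → ∀ m : M, s a a • m = 0) :
    HasProjectiveDimensionLT (ModuleCat.of R M) k := by
  induction j generalizing M with
  | zero =>
    have : Subsingleton M := ⟨fun x y => h.ext_smul fun a => by
      rw [hM a (Nat.zero_le a), hM a (Nat.zero_le a)]⟩
    have := (ModuleCat.isZero_of_subsingleton (ModuleCat.of R M)).hasProjectiveDimensionLT_zero
    exact hasProjectiveDimensionLT_of_ge _ 0 _ (Nat.zero_le k)
  | succ j ih =>
    let N := h.vanishingSubmodule (j := j) (M := M) fun a ha => hM a ha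
    have hS := shortExact_of_linearMap N.injective_subtype (LinearMap.exact_subtype_mkQ N)
      N.mkQ_surjective
    refine hS.hasProjectiveDimensionLT_X₂ k ?_ ?_
    · refine ih (by omega) N fun a ha m => Subtype.ext ?_
      change s a a • (m : M) = 0
      obtain ha | rfl := Nat.lt_or_eq_of_le ha
      · exact hM a ha m
      · exact m.2
    · obtain ⟨ι, ⟨e⟩⟩ := h.exists_equiv_finsupp_simple (j := j) (M := M ⧸ N) <| by
        -- Modulo `N` only the component at `j` matters, and a nontrivial path ending at `j` starts
        -- above `j`, where `M` vanishes.
        intro a b hab m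
        obtain ⟨m, rfl⟩ := N.mkQ_surjective m
        rw [← map_smul, Submodule.mkQ_apply, Submodule.Quotient.mk_eq_zero,
          h.mem_vanishingSubmodule]
        by_cases hb : b = j
        · subst hb
          rw [h.idem_smul, ← h.smul_idem]
          rcases lt_trichotomy a b with ha | ha | ha
          · rw [h.eq_zero_of_lt ha, zero_smul]
          · exact absurd ⟨ha, rfl⟩ hab
          · rw [hM a ha, smul_zero]
        · exact h.smul_smul_of_ne hb m
      have : HasProjectiveDimensionLT (ModuleCat.of R (ι →₀ h.Cyclic j j)) k := by
        by_cases hjk : j < k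
        · have := h.hasProjectiveDimensionLT_finsupp_simple_of_lt ι hjk (by omega)
          exact hasProjectiveDimensionLT_of_ge _ (j + 1) _ (by omega)
        · have := h.hasProjectiveDimensionLT_finsupp_simple_of_ge ι hk (Nat.le_of_not_lt hjk) (by omega)
          exact hasProjectiveDimensionLT_of_ge _ 2 _ hk
      exact hasProjectiveDimensionLT_of_iso e.toModuleIso k

/-- The same syzygies `S_j` of `S_{j+1}` shift the dimension exactly. The shift needs a bound of at
least `2` on the quotient, so `S_1` is treated by hand as a non-projective module. -/
theorem not_hasProjectiveDimensionLT_simple {j : ℕ} (hjk : j < k) (hjn : j < n) :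
    ¬ HasProjectiveDimensionLT (ModuleCat.of R (h.Cyclic j j)) j := by
  have hne : ∀ j < n, h.gen j j ≠ 0 := fun j hj h0 => by
    rw [← h.idem_smul_gen, h.smul_gen_eq_zero_iff_of_path] at h0
    exact h0.elim (lt_irrefl _) fun h' => h' ⟨le_rfl, hj, by omega⟩
  induction j with
  | zero =>
    intro h0
    have := ModuleCat.subsingleton_of_isZero (isZero_of_hasProjectiveDimensionLT_zero
      (ModuleCat.of R (h.Cyclic 0 0)))
    exact hne 0 hjn (Subsingleton.elim (α := h.Cyclic 0 0) _ _)
  | succ j ih =>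
    intro hlt
    have hsurj := h.cyclicLift_surjective (t := j + 1) (Nat.zero_le (j + 1))
    cases j with
    | zero =>
      have := (IsProjective.iff_projective (R := R) (h.Cyclic 1 1)).2
        (projective_iff_hasProjectiveDimensionLT_one.2 hlt)
      obtain ⟨σ, hσ⟩ := Module.projective_lifting_property _ LinearMap.id hsurj
      obtain ⟨κ, hκ⟩ := h.exists_idem_smul_eq (σ (h.gen 1 1)) 1
      rw [h.idem_smul_map_gen] at hκ
      -- A section sends the generator to `κ` times that of `P_1`. The arrow `1 → 0` kills the
      -- generator of `S_1` but not that of `P_1`, so `κ = 0`.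
      have h1 : (κ • s 1 0) • h.gen 1 0 = 0 := by
        rw [← h.mul_right_idem 1 0, ← mul_smul_comm, mul_smul, ← hκ, ← map_smul,
          show s 1 0 • h.gen 1 (0 + 1) = 0 from h.smul_gen_eq_zero_of_lt one_pos, map_zero]
      have h2 := (h.smul_smul_gen_eq_zero_iff.1 h1).resolve_right
        (by rintro (h' | h'); exacts [absurd h' (by omega), h' ⟨by omega, hjn, by omega⟩])
      have h3 := LinearMap.congr_fun hσ (h.gen 1 1)
      rw [LinearMap.comp_apply, hκ, h2, zero_smul, zero_smul, map_zero] at h3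
      exact hne 1 hjn h3.symm
    | succ j =>
      have hinj := h.cyclicLift_injective (q := j + 1) (t := j + 1 + 1) (l := 0) (l' := j + 1)
        (by omega) (fun c _ _ => Or.inr fun h' => by have := h'.2.2; omega)
        (fun c _ h' => ⟨by omega, by have := h'.1; exact ⟨by omega, hjn, by omega⟩⟩)
      have hex := h.cyclicLift_exact (q := j + 1) (t := j + 1 + 1) (l := j + 1 + 1) (l' := j + 1)
        (by omega) (fun c _ _ h' => by have := h'.2.2; omega) (by omega) (fun c _ _ => by omega)
      have hS := shortExact_of_linearMap hinj hex hsurj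
      have hP := (IsProjective.iff_projective (R := R) (h.Cyclic (j + 1 + 1) 0)).1
        (h.projective_cyclic _)
      exact ih (by omega) (by omega) ((hS.hasProjectiveDimensionLT_X₃_iff j hP).1 hlt)

end IsLeftChainSystem

theorem IsChainSystem.globalDimension_eq {K A : Type u} [Field K] [Ring A] [Algebra K A] {n k : ℕ}
    {r : ℕ → ℕ → A} (h : IsChainSystem K n k r) (hk : 2 ≤ k) (hkn : k ≤ n) :
    globalDimension A = ((k - 1 : ℕ) : WithBot ℕ∞) := by
  refine le_antisymm (iSup_le fun M => ?_) ?_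
  · rw [projectiveDimension_le_iff]
    have := h.op.hasProjectiveDimensionLT_of_vanishing hk le_rfl M fun a ha m => by
      have : ¬ GoodPair n k a a := fun h' => by have := h'.2.1; omega
      rw [h.op.eq_zero a a this, zero_smul]
    exact hasProjectiveDimensionLT_of_ge _ k _ (by omega)
  · refine le_iSup_of_le (ModuleCat.of Aᵐᵒᵖ (h.op.Cyclic (k - 1) (k - 1))) ?_
    rw [projectiveDimension_ge_iff]
    exact h.op.not_hasProjectiveDimensionLT_simple (by omega) (by omega)

/-- The submodule `N` is a first syzygy of `P ⧸ N`, which has projective dimension at most one. -/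
theorem isHereditary_of_globalDimension_le_one {A : Type u} [Ring A] (hA : globalDimension A ≤ 1) :
    IsHereditary A := by
  intro P _ _ hP N
  have hS := shortExact_of_linearMap N.injective_subtype (LinearMap.exact_subtype_mkQ N)
    N.mkQ_surjective
  have h1 : HasProjectiveDimensionLT (ModuleCat.of Aᵐᵒᵖ (P ⧸ N)) 2 := by
    have : projectiveDimension (ModuleCat.of Aᵐᵒᵖ (P ⧸ N)) ≤ (1 : ℕ) :=
      (le_iSup (fun M : ModuleCat.{u} Aᵐᵒᵖ => projectiveDimension M) _).trans hA
    rwa [projectiveDimension_le_iff] at this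
  have hP' := (IsProjective.iff_projective (R := Aᵐᵒᵖ) P).1 hP
  exact (IsProjective.iff_projective (R := Aᵐᵒᵖ) N).2
    (projective_iff_hasProjectiveDimensionLT_one.2
      ((hS.hasProjectiveDimensionLT_X₃_iff 0 hP').1 h1))

/-! ### A tilting module -/

/-- As `Y` is projective, every class in `Ext¹(Z, W)` is the connecting image of some `φ : X → W`; a
`φ` that extends to `Y` has connecting image zero. -/
theorem subsingleton_ext_one_of_extends {R : Type u} [Ring R] {X Y Z W : Type u}
    [AddCommGroup X] [Module R X] [AddCommGroup Y] [Module R Y] [AddCommGroup Z] [Module R Z]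
    [AddCommGroup W] [Module R W] [Module.Projective R Y] {f : X →ₗ[R] Y} {g : Y →ₗ[R] Z}
    (hf : Function.Injective f) (hfg : Function.Exact f g) (hg : Function.Surjective g)
    (hW : ∀ φ : X →ₗ[R] W, ∃ ψ : Y →ₗ[R] W, ψ ∘ₗ f = φ) :
    Subsingleton (Abelian.Ext.{u} (ModuleCat.of R Z) (ModuleCat.of R W) 1) := by
  have hS := shortExact_of_linearMap hf hfg hg
  have := (IsProjective.iff_projective (R := R) Y).1 inferInstance
  refine subsingleton_of_forall_eq 0 fun x => ?_
  obtain ⟨x₁, rfl⟩ := Abelian.Ext.contravariant_sequence_exact₃ hS (ModuleCat.of R W) x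
    (Abelian.Ext.eq_zero_of_projective (P := ModuleCat.of R Y) _) (add_zero 1)
  obtain ⟨ψ, hψ⟩ := hW (Abelian.Ext.homEquiv₀ x₁).hom
  have h1 : x₁ = (Abelian.Ext.mk₀ (ModuleCat.ofHom f)).comp
      (Abelian.Ext.mk₀ (ModuleCat.ofHom ψ)) (zero_add 0) := by
    rw [Abelian.Ext.mk₀_comp_mk₀, ← ModuleCat.ofHom_comp, hψ, ModuleCat.ofHom_hom,
      Abelian.Ext.mk₀_homEquiv₀_apply]
  rw [h1]
  exact hS.extClass_comp_assoc _

theorem projective_pi {R ι : Type*} [Ring R] [Fintype ι] (X : ι → Type*) [∀ i, AddCommGroup (X i)]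
    [∀ i, Module R (X i)] [∀ i, Module.Projective R (X i)] : Module.Projective R (∀ i, X i) := by
  classical
  exact Module.Projective.of_equiv (DirectSum.linearEquivFunOnFintype R ι X)

theorem exact_piMap {R ι : Type*} [Ring R] {X Y Z : ι → Type*} [∀ i, AddCommGroup (X i)]
    [∀ i, Module R (X i)] [∀ i, AddCommGroup (Y i)] [∀ i, Module R (Y i)]
    [∀ i, AddCommGroup (Z i)] [∀ i, Module R (Z i)] {f : ∀ i, X i →ₗ[R] Y i}
    {g : ∀ i, Y i →ₗ[R] Z i} (hfg : ∀ i, Function.Exact (f i) (g i)) :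
    Function.Exact (LinearMap.piMap f) (LinearMap.piMap g) := by
  intro y
  constructor
  · intro hy
    choose x hx using fun i => (hfg i (y i)).1 (congrFun hy i)
    exact ⟨x, funext hx⟩
  · rintro ⟨x, rfl⟩
    exact funext fun i => (hfg i _).2 ⟨x i, rfl⟩

theorem piMap_single {R ι : Type*} [Ring R] [DecidableEq ι] {X Y : ι → Type*}
    [∀ i, AddCommGroup (X i)] [∀ i, Module R (X i)] [∀ i, AddCommGroup (Y i)] [∀ i, Module R (Y i)]
    (f : ∀ i, X i →ₗ[R] Y i) (i : ι) (x : X i) :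
    LinearMap.piMap f (Pi.single i x) = Pi.single i (f i x) := by
  funext j
  exact Pi.apply_single (fun i => f i) (fun i => map_zero _) i x j

theorem inAdd_pi {R : Type u} [Ring R] {T : Type u} [AddCommGroup T] [Module R T] {m : ℕ}
    {X : Fin m → Type u} [∀ i, AddCommGroup (X i)] [∀ i, Module R (X i)]
    (hX : ∀ i, ∃ (f : X i →ₗ[R] T) (g : T →ₗ[R] X i), g ∘ₗ f = LinearMap.id) :
    InAdd R T (∀ i, X i) := by
  choose f g hgf using hX
  exact ⟨m, LinearMap.piMap f, LinearMap.piMap g, LinearMap.ext fun x => funext fun i =>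
    LinearMap.congr_fun (hgf i) (x i)⟩

/-! ### Matrix entries of endomorphisms of a product -/

section BlockEnd

variable {R ι : Type*} [Ring R] [DecidableEq ι] {X : ι → Type*} [∀ i, AddCommGroup (X i)]
  [∀ i, Module R (X i)]

/-- The endomorphism of a product with a single nonzero matrix entry. -/
def blockEnd (a b : ι) (f : X b →ₗ[R] X a) : Module.End R (∀ i, X i) :=
  LinearMap.single R X a ∘ₗ f ∘ₗ LinearMap.proj b

theorem blockEnd_apply (a b : ι) (f : X b →ₗ[R] X a) (x : ∀ i, X i) :
    blockEnd a b f x = Pi.single a (f (x b)) := rfl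

theorem blockEnd_mul (a b c : ι) (f : X b →ₗ[R] X a) (g : X c →ₗ[R] X b) :
    blockEnd a b f * blockEnd b c g = blockEnd a c (f ∘ₗ g) := by
  refine LinearMap.ext fun x => ?_
  rw [Module.End.mul_apply, blockEnd_apply, blockEnd_apply, blockEnd_apply, Pi.single_eq_same,
    LinearMap.comp_apply]

theorem blockEnd_mul_of_ne {b c : ι} (hbc : b ≠ c) (a d : ι) (f : X b →ₗ[R] X a)
    (g : X d →ₗ[R] X c) : blockEnd a b f * blockEnd c d g = 0 := by
  refine LinearMap.ext fun x => ?_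
  rw [Module.End.mul_apply, blockEnd_apply, blockEnd_apply, Pi.single_eq_of_ne hbc, map_zero,
    Pi.single_zero, LinearMap.zero_apply]

@[simp]
theorem blockEnd_zero (a b : ι) : blockEnd a b (0 : X b →ₗ[R] X a) = 0 := by
  rw [blockEnd, LinearMap.zero_comp, LinearMap.comp_zero]

theorem blockEnd_eq_zero_iff {a b : ι} {f : X b →ₗ[R] X a} : blockEnd a b f = 0 ↔ f = 0 := by
  refine ⟨fun h0 => LinearMap.ext fun x => ?_, fun h0 => by rw [h0, blockEnd_zero]⟩
  have := congrFun (LinearMap.congr_fun h0 (Pi.single b x)) a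
  rwa [blockEnd_apply, Pi.single_eq_same, Pi.single_eq_same] at this

theorem sum_blockEnd_id [Fintype ι] : ∑ a, blockEnd a a (LinearMap.id : X a →ₗ[R] X a) = 1 := by
  rw [Module.End.one_eq_id, ← LinearMap.lsum_single (R := R) (φ := X) ℕ]
  rfl

theorem sum_sum_blockEnd [Fintype ι] (x : Module.End R (∀ i, X i)) :
    ∑ a : ι, ∑ b : ι, blockEnd (X := X) a b (LinearMap.proj a ∘ₗ x ∘ₗ LinearMap.single R X b) = x := by
  have h1 : ∀ a b : ι, blockEnd (X := X) a b (LinearMap.proj a ∘ₗ x ∘ₗ LinearMap.single R X b) =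
      blockEnd (X := X) a a LinearMap.id * (x * blockEnd (X := X) b b LinearMap.id) := fun _ _ => rfl
  simp_rw [h1, ← Finset.mul_sum]
  rw [← Finset.sum_mul, sum_blockEnd_id, one_mul, mul_one]

end BlockEnd

/-! ### Summands of the tilting module: numerical data -/

/-- The `i`-th summand of the tilting module is a quotient of the projective module at this vertex. -/
def tiltTop (n k i : ℕ) : ℕ := if i + 1 < k then i else n - 1

/-- The `i`-th summand of the tilting module lives at the vertices that are at least this one. -/
def tiltCut (k i : ℕ) : ℕ := if i < k then 0 else i

/-- The vertex of the syzygy of the `i`-th summand; it is `n` if the summand is projective. -/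
def tiltSyzygy (n k i : ℕ) : ℕ := if i < k then n else i - 1

theorem le_tiltTop {n k i : ℕ} (hi : i < n) : i ≤ tiltTop n k i := by
  unfold tiltTop; split_ifs <;> omega

theorem tiltTop_mono {n k a b : ℕ} (hba : b ≤ a) (ha : a < n) :
    tiltTop n k b ≤ tiltTop n k a := by
  unfold tiltTop; split_ifs <;> omega

theorem tiltCut_mono {k a b : ℕ} (hba : b ≤ a) : tiltCut k b ≤ tiltCut k a := by
  unfold tiltCut; split_ifs <;> omega

theorem goodPair_tiltTop {n k j c : ℕ} (hkn : k < n) (h : GoodPair n k j c) :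
    GoodPair n k (tiltTop n k j) c := by
  unfold tiltTop
  split_ifs with hj
  · exact h
  · obtain ⟨h1, h2, h3⟩ := h
    exact ⟨by omega, by omega, by omega⟩

/-- The numerical core of `End T ≅ A(n, k + 1)`: the right-hand side says that the canonical map
from summand `b` to summand `a` is nonzero. -/
theorem goodPair_succ_iff {n k a b : ℕ} (hkn : k < n) (hba : b ≤ a) (ha : a < n) :
    GoodPair n (k + 1) a b ↔
      tiltCut k a ≤ tiltTop n k b ∧ GoodPair n k (tiltTop n k a) (tiltTop n k b) := by
  unfold GoodPair tiltTop tiltCut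
  split_ifs <;> omega

namespace IsLeftChainSystem

section Structure

variable {K R : Type*} [Field K] [Ring R] [Algebra K R] {n k : ℕ} {s : ℕ → ℕ → R}
  (h : IsLeftChainSystem K n k s)

/-- The summands of the tilting module. -/
abbrev TiltSummand (i : ℕ) : Type _ := h.Cyclic (tiltTop n k i) (tiltCut k i)

/-- The tilting module. -/
abbrev Tilt : Type _ := ∀ i : Fin n, h.TiltSummand i

/-- The generators of the summands of the tilting module. -/
def tiltGen (i : ℕ) : h.TiltSummand i := h.gen (tiltTop n k i) (tiltCut k i)

include h

/-- This makes the value `n` of `tiltSyzygy` encode a zero syzygy, so projective and non-projective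
summands share one form of resolution. -/
theorem subsingleton_cyclic {q l : ℕ} (hq : n ≤ q) : Subsingleton (h.Cyclic q l) :=
  ⟨fun x y => h.ext_smul fun c => by
    obtain ⟨κ, hκ⟩ := h.exists_idem_smul_eq x c
    obtain ⟨μ, hμ⟩ := h.exists_idem_smul_eq y c
    have hz : s q c = 0 := h.eq_zero _ _ fun h' => by have := h'.2.1; omega
    rw [hκ, hμ, hz, smul_zero, smul_zero, zero_smul]⟩

theorem cyclicLift_gen_path (t q : ℕ) :
    h.cyclicLift q 0 (s t q • h.gen t 0) (h.gen q 0) = s t q • h.gen t 0 :=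
  h.cyclicLift_gen (h.idem_smul _ _ _) (by simp)

theorem cyclicLift_tiltTop_injective (hkn : k < n) {j : ℕ} (hj : j < n) :
    Function.Injective (h.cyclicLift j 0 (s (tiltTop n k j) j • h.gen (tiltTop n k j) 0)) :=
  h.cyclicLift_injective (le_tiltTop hj) (by simp) fun c _ hc =>
    ⟨Nat.zero_le c, goodPair_tiltTop hkn hc⟩

theorem cyclicLift_tiltTop_exact {j : ℕ} (hj : j < n) :
    Function.Exact (h.cyclicLift j 0 (s (tiltTop n k j) j • h.gen (tiltTop n k j) 0))
      (h.cyclicLift (tiltTop n k j) 0 (h.gen (tiltTop n k j) (j + 1))) :=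
  h.cyclicLift_exact (le_tiltTop hj) (by simp) (Or.inl j.lt_succ_self) fun _ hc _ =>
    Nat.le_of_lt_succ hc

theorem tiltResolution_injective (hk : 2 ≤ k) (hkn : k < n) {i : ℕ} (hi : i < n) :
    Function.Injective (h.cyclicLift (tiltSyzygy n k i) 0
      (s (tiltTop n k i) (tiltSyzygy n k i) • h.gen (tiltTop n k i) 0)) := by
  by_cases hik : i < k
  · have := h.subsingleton_cyclic (q := tiltSyzygy n k i) (l := 0) (by rw [tiltSyzygy, if_pos hik])
    exact Function.injective_of_subsingleton _
  · have h1 : tiltSyzygy n k i = i - 1 := if_neg hik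
    have h2 : tiltTop n k i = tiltTop n k (i - 1) := by
      rw [tiltTop, tiltTop, if_neg (by omega), if_neg (by omega)]
    rw [h1, h2]
    exact h.cyclicLift_tiltTop_injective hkn (by omega)

theorem tiltResolution_exact (hk : 2 ≤ k) {i : ℕ} (hi : i < n) :
    Function.Exact (h.cyclicLift (tiltSyzygy n k i) 0
      (s (tiltTop n k i) (tiltSyzygy n k i) • h.gen (tiltTop n k i) 0))
      (h.cyclicLift (tiltTop n k i) 0 (h.gen (tiltTop n k i) (tiltCut k i))) := by
  by_cases hik : i < k
  · have := h.subsingleton_cyclic (q := tiltSyzygy n k i) (l := 0) (by rw [tiltSyzygy, if_pos hik])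
    have h1 : tiltCut k i = 0 := if_pos hik
    have h2 : h.cyclicLift (tiltTop n k i) 0 (h.gen (tiltTop n k i) 0) = LinearMap.id :=
      h.hom_ext (h.cyclicLift_gen_of_le le_rfl)
    rw [h1, h2]
    intro y
    constructor
    · rintro rfl
      exact ⟨0, map_zero _⟩
    · rintro ⟨x, rfl⟩
      rw [Subsingleton.elim x 0, map_zero, map_zero]
  · have h1 : tiltSyzygy n k i = i - 1 := if_neg hik
    have h2 : tiltTop n k i = tiltTop n k (i - 1) := by
      rw [tiltTop, tiltTop, if_neg (by omega), if_neg (by omega)]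
    have h3 : tiltCut k i = i - 1 + 1 := by rw [tiltCut, if_neg hik]; omega
    rw [h1, h2, h3]
    exact h.cyclicLift_tiltTop_exact (by omega)

/-- A map from `P_q` to `T` is an element `y` of `T` at the vertex `q`. Extending it along the
inclusion of the syzygy means writing `y` as the path from the top to `q` applied to an element at
the top. -/
theorem exists_tilt_extension {i : ℕ} (y : h.Tilt)
    (hy : s (tiltSyzygy n k i) (tiltSyzygy n k i) • y = y) :
    ∃ m : h.Tilt, s (tiltTop n k i) (tiltTop n k i) • m = m ∧
      s (tiltTop n k i) (tiltSyzygy n k i) • m = y := by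
  have key : ∀ a : Fin n, ∃ m : h.TiltSummand a, s (tiltTop n k i) (tiltTop n k i) • m = m ∧
      s (tiltTop n k i) (tiltSyzygy n k i) • m = y a := by
    intro a
    obtain ⟨κ, hκ⟩ := h.exists_idem_smul_eq (y a) (tiltSyzygy n k i)
    have hya : s (tiltSyzygy n k i) (tiltSyzygy n k i) • y a = y a := congrFun hy a
    rw [hya] at hκ
    rw [hκ]
    by_cases hz : GoodPair n k (tiltTop n k a) (tiltSyzygy n k i)
    -- Here the syzygy vertex is `i - 1 ≥ k - 1`. The summands `P_0, …, P_{k-2}` do not reach it, so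
    -- summand `a` has top `n - 1`, as does summand `i`.
    · have ht : tiltTop n k i = tiltTop n k a := by
        have h1 := hz.1
        have h2 := hz.2.1
        have h3 := a.2
        revert h1 h2
        unfold tiltTop tiltSyzygy
        split_ifs <;> omega
      rw [ht]
      refine ⟨(κ • s (tiltTop n k a) (tiltTop n k a)) • h.tiltGen a, ?_, ?_⟩
      · rw [smul_smul, mul_smul_comm, h.mul_left_idem]
      · rw [smul_smul, mul_smul_comm, h.mul_right_idem]
        rfl
    · exact ⟨0, smul_zero _, by rw [h.eq_zero _ _ hz, smul_zero, smul_zero, zero_smul]⟩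
  choose m hm hm' using key
  exact ⟨m, funext hm, funext hm'⟩

theorem exists_retract_tilt {t l : ℕ} (htl : (∃ i : Fin n, tiltTop n k i = t ∧ tiltCut k i = l) ∨
    Subsingleton (h.Cyclic t l)) :
    ∃ (f : h.Cyclic t l →ₗ[R] h.Tilt) (g : h.Tilt →ₗ[R] h.Cyclic t l), g ∘ₗ f = LinearMap.id := by
  obtain ⟨i, rfl, rfl⟩ | hsub := htl
  · exact ⟨LinearMap.single R (fun i : Fin n => h.TiltSummand i) i, LinearMap.proj i,
      LinearMap.proj_comp_single_same R (fun i : Fin n => h.TiltSummand i) i⟩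
  · exact ⟨0, 0, LinearMap.ext fun x => Subsingleton.elim _ _⟩

theorem subsingleton_cyclic_of_lt {t : ℕ} {l : ℕ} (htl : t < l) : Subsingleton (h.Cyclic t l) := by
  refine subsingleton_of_forall_eq 0 fun y => ?_
  obtain ⟨x, rfl⟩ := h.exists_eq_smul_gen y
  rw [← h.idem_smul_gen, h.smul_gen_eq_zero_of_lt htl, smul_zero]

/-- The regular module is the direct sum of the indecomposable projective modules. -/
theorem pi_smul_gen_bijective :
    Function.Bijective (LinearMap.pi fun j : Fin n => (h.annihilator (j : ℕ) 0).mkQ) := by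
  constructor
  · rw [injective_iff_map_eq_zero]
    intro x hx
    have hx' : ∀ j ∈ Finset.range n, x * s j j = 0 := fun j hj => by
      have h1 : x • h.gen j 0 = 0 := (h.smul_gen_eq_mk j 0 x).trans
        (congrFun hx ⟨j, Finset.mem_range.1 hj⟩)
      rw [h.smul_gen_eq_zero_iff] at h1
      exact h.ext_smul fun c => by rw [smul_zero, smul_eq_mul, ← mul_assoc, h1 c c.zero_le]
    rw [← mul_one x, ← h.sum_eq_one, Finset.mul_sum]
    exact Finset.sum_eq_zero hx'
  · intro y
    choose x hx using fun j => h.exists_eq_smul_gen (y j)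
    refine ⟨∑ j : Fin n, x j * s j j, funext fun i => ?_⟩
    change (h.annihilator (i : ℕ) 0).mkQ (∑ j : Fin n, x j * s j j) = y i
    rw [← h.smul_gen_eq_mk, Finset.sum_smul, Finset.sum_eq_single i]
    · rw [mul_smul, h.idem_smul_gen, ← hx]
    · intro j _ hj
      rw [mul_smul, h.smul_eq_zero_of_ne (h.idem_smul_gen i 0) fun h' => hj (Fin.ext h').symm,
        smul_zero]
    · exact fun hi => absurd (Finset.mem_univ i) hi

/-! ### Its endomorphism algebra -/

/-- The canonical homomorphisms between the summands of the tilting module. -/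
noncomputable def tiltHom (a b : ℕ) : h.TiltSummand b →ₗ[R] h.TiltSummand a :=
  h.cyclicLift _ _ (s (tiltTop n k a) (tiltTop n k b) • h.tiltGen a)

theorem tiltHom_gen {a b : ℕ} (hba : b ≤ a) (ha : a < n) :
    h.tiltHom a b (h.tiltGen b) = s (tiltTop n k a) (tiltTop n k b) • h.tiltGen a := by
  refine h.cyclicLift_gen (h.idem_smul _ _ _) fun c hc => ?_
  by_cases hcb : c ≤ tiltTop n k b
  · rw [h.smul_smul_of_le hcb (tiltTop_mono hba ha)]
    exact h.smul_gen_eq_zero_of_lt (hc.trans_le (tiltCut_mono hba))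
  · rw [h.eq_zero_of_lt (by omega), zero_smul]

theorem tiltHom_comp {a b c : ℕ} (hcb : c ≤ b) (hba : b ≤ a) (ha : a < n) :
    h.tiltHom a b ∘ₗ h.tiltHom b c = h.tiltHom a c := by
  refine h.hom_ext ?_
  change h.tiltHom a b (h.tiltHom b c (h.tiltGen c)) = h.tiltHom a c (h.tiltGen c)
  rw [h.tiltHom_gen hcb (by omega), map_smul, h.tiltHom_gen hba ha, h.tiltHom_gen (by omega) ha,
    h.smul_smul_of_le (tiltTop_mono hcb (by omega)) (tiltTop_mono hba ha)]

theorem tiltHom_self {a : ℕ} (ha : a < n) : h.tiltHom a a = LinearMap.id :=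
  h.hom_ext ((h.tiltHom_gen le_rfl ha).trans (h.idem_smul_gen _ _))

theorem tiltHom_eq_zero_iff (hkn : k < n) {a b : ℕ} (hba : b ≤ a) (ha : a < n) :
    h.tiltHom a b = 0 ↔ ¬ GoodPair n (k + 1) a b := by
  have h1 : h.tiltHom a b = 0 ↔ s (tiltTop n k a) (tiltTop n k b) • h.tiltGen a = 0 := by
    rw [← h.tiltHom_gen hba ha]
    refine ⟨fun h0 => by rw [h0, LinearMap.zero_apply], fun h0 => h.hom_ext ?_⟩
    rw [LinearMap.zero_apply]
    exact h0
  rw [h1, goodPair_succ_iff hkn hba ha, tiltGen, h.smul_gen_eq_zero_iff_of_path, not_and_or, not_le]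

theorem exists_eq_smul_tiltHom {a b : ℕ} (hba : b ≤ a) (ha : a < n)
    (f : h.TiltSummand b →ₗ[R] h.TiltSummand a) :
    ∃ κ : K, ∀ x, f x = κ • h.tiltHom a b x := by
  obtain ⟨κ, hκ⟩ := h.exists_idem_smul_eq (f (h.tiltGen b)) (tiltTop n k b)
  refine ⟨κ, fun x => ?_⟩
  rw [tiltGen, h.idem_smul_map_gen f] at hκ
  obtain ⟨x, rfl⟩ := h.exists_eq_smul_gen x
  have h1 := h.tiltHom_gen hba ha
  rw [tiltGen, tiltGen] at h1
  rw [map_smul, map_smul, hκ, h1, smul_assoc, smul_comm]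

/-- Either summand `a` has no component at the top of summand `b`, or both are quotients of
`P_{n-1}` and `b` has the larger cut. -/
theorem eq_zero_of_tiltSummand_lt (hkn : k < n) {a b : ℕ} (hab : a < b) (hb : b < n)
    (f : h.TiltSummand b →ₗ[R] h.TiltSummand a) : f = 0 := by
  refine h.hom_ext ?_
  rw [LinearMap.zero_apply]
  obtain ⟨κ, hκ⟩ := h.exists_idem_smul_eq (f (h.tiltGen b)) (tiltTop n k b)
  rw [tiltGen, h.idem_smul_map_gen f] at hκ
  rw [hκ, h.smul_smul_gen_eq_zero_iff]
  by_cases hak : a + 1 < k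
  · refine Or.inr (Or.inr fun h' => ?_)
    have := h'.1
    unfold tiltTop at this
    split_ifs at this <;> omega
  -- Both tops are `n - 1`, so `f` multiplies the generator by `κ`. The path to `b - 1` kills the
  -- generator of summand `b`, but not that of summand `a`, whose cut is at most `b - 1`.
  · left
    have htb : tiltTop n k b = n - 1 := if_neg (by omega)
    have hta : tiltTop n k a = n - 1 := if_neg hak
    have hcb : tiltCut k b = b := if_neg (by omega)
    have hzero : s (tiltTop n k b) (b - 1) • f (h.gen (tiltTop n k b) (tiltCut k b)) = 0 := by
      rw [← map_smul, h.smul_gen_eq_zero_of_lt (by omega), map_zero]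
    rw [hκ, smul_smul, mul_smul_comm, h.mul _ _ _ (by omega) (by omega),
      h.smul_smul_gen_eq_zero_iff] at hzero
    refine hzero.resolve_right ?_
    rw [hta]
    rintro (h' | h')
    · unfold tiltCut at h'
      split_ifs at h' <;> omega
    · exact h' ⟨by omega, by omega, by omega⟩

/-- The canonical endomorphisms of the tilting module. -/
noncomputable def tiltEnd (a b : ℕ) : Module.End R h.Tilt :=
  if hab : b ≤ a ∧ a < n then
    blockEnd (X := fun i : Fin n => h.TiltSummand i) (⟨a, hab.2⟩ : Fin n)
      (⟨b, hab.1.trans_lt hab.2⟩ : Fin n) (h.tiltHom a b)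
  else 0

theorem tiltEnd_val {a b : Fin n} (hba : b ≤ a) : h.tiltEnd a b =
    blockEnd (X := fun i : Fin n => h.TiltSummand i) a b (h.tiltHom a b) := dif_pos ⟨hba, a.2⟩

theorem tiltEnd_eq_zero {a b : ℕ} (hab : ¬ (b ≤ a ∧ a < n)) : h.tiltEnd a b = 0 := dif_neg hab

/-- A map from summand `b` to summand `a` plays the role of the path `a → b`. Composition of
endomorphisms then matches left-to-right products of paths, so this is the right-handed notion
although `h` is left-handed. -/
theorem isChainSystem_tiltEnd (hkn : k < n) :
    IsChainSystem K n (k + 1) h.tiltEnd where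
  eq_zero a b hab := by
    by_cases h' : b ≤ a ∧ a < n
    · lift a to Fin n using h'.2
      lift b to Fin n using h'.1.trans_lt a.2
      rw [h.tiltEnd_val h'.1, blockEnd_eq_zero_iff]
      exact (h.tiltHom_eq_zero_iff hkn h'.1 a.2).2 hab
    · exact h.tiltEnd_eq_zero h'
  ne_zero a b hab := by
    lift a to Fin n using hab.2.1
    lift b to Fin n using hab.1.trans_lt a.2
    rw [h.tiltEnd_val hab.1, Ne, blockEnd_eq_zero_iff]
    exact fun h0 => (h.tiltHom_eq_zero_iff hkn hab.1 a.2).1 h0 hab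
  mul a b c hcb hba := by
    by_cases ha : a < n
    · lift a to Fin n using ha
      lift b to Fin n using hba.trans_lt a.2
      lift c to Fin n using hcb.trans_lt b.2
      rw [h.tiltEnd_val hba, h.tiltEnd_val hcb, h.tiltEnd_val (hcb.trans hba), blockEnd_mul]
      exact congrArg _ (h.tiltHom_comp hcb hba a.2)
    · have h0 : ∀ d, h.tiltEnd a d = 0 := fun d => h.tiltEnd_eq_zero fun h' => ha h'.2
      rw [h0, h0, zero_mul]
  mul_of_ne a b c d hbc := by
    by_cases h1 : b ≤ a ∧ a < n
    · by_cases h2 : d ≤ c ∧ c < n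
      · lift a to Fin n using h1.2
        lift b to Fin n using h1.1.trans_lt a.2
        lift c to Fin n using h2.2
        lift d to Fin n using h2.1.trans_lt c.2
        rw [h.tiltEnd_val h1.1, h.tiltEnd_val h2.1]
        exact blockEnd_mul_of_ne (fun h' => hbc (congrArg Fin.val h')) _ _ _ _
      · rw [h.tiltEnd_eq_zero h2, mul_zero]
    · rw [h.tiltEnd_eq_zero h1, zero_mul]
  sum_eq_one := by
    rw [Finset.sum_range, ← sum_blockEnd_id]
    refine Finset.sum_congr rfl fun a _ => ?_
    rw [h.tiltEnd_val le_rfl]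
    exact congrArg _ (h.tiltHom_self a.2)
  mem_span x := by
    rw [← sum_sum_blockEnd x]
    refine Submodule.sum_mem _ fun a _ => Submodule.sum_mem _ fun b _ => ?_
    generalize LinearMap.proj a ∘ₗ x ∘ₗ LinearMap.single R (fun i : Fin n => h.TiltSummand i) b = f
    by_cases hba : b ≤ a
    · obtain ⟨κ, hκ⟩ := h.exists_eq_smul_tiltHom hba a.2 f
      have hf : blockEnd a b f = κ • h.tiltEnd a b := by
        rw [h.tiltEnd_val hba]
        refine LinearMap.ext fun y => ?_
        rw [LinearMap.smul_apply, blockEnd_apply, blockEnd_apply, hκ]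
        exact Pi.single_smul a κ _
      rw [hf]
      exact Submodule.smul_mem _ _ (Submodule.subset_span ⟨(a, b), rfl⟩)
    · have hf : f = 0 := h.eq_zero_of_tiltSummand_lt hkn (not_le.1 hba) b.2 f
      rw [hf, blockEnd_zero]
      exact Submodule.zero_mem _

end Structure

end IsLeftChainSystem

/-! ### Verification of the tilting axioms and induction on `k` -/

/-- The module `Aᵐᵒᵖ` over itself is the regular right module. -/
def regularRightModuleEquiv (A : Type*) [Ring A] : A ≃ₗ[Aᵐᵒᵖ] Aᵐᵒᵖ where
  __ := MulOpposite.opAddEquiv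
  map_smul' _ _ := rfl

theorem IsChainSystem.isTilting {K A : Type u} [Field K] [Ring A] [Algebra K A] {n k : ℕ}
    {r : ℕ → ℕ → A} (h : IsChainSystem K n k r) (hk : 2 ≤ k) (hkn : k < n) :
    IsTilting A h.op.Tilt := by
  have hproj := h.op.projective_cyclic
  have hP : Module.Projective Aᵐᵒᵖ (∀ i : Fin n, h.op.Cyclic (tiltTop n k i) 0) := projective_pi _
  have hQ : Module.Projective Aᵐᵒᵖ (∀ i : Fin n, h.op.Cyclic (tiltSyzygy n k i) 0) := projective_pi _
  have hinj := Function.Injective.piMap fun i : Fin n => h.op.tiltResolution_injective hk hkn i.2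
  have hex := exact_piMap fun i : Fin n => h.op.tiltResolution_exact hk i.2
  have hsurj := Function.Surjective.piMap fun i : Fin n => h.op.cyclicLift_surjective
    (t := tiltTop n k i) (Nat.zero_le (tiltCut k i))
  rw [← LinearMap.coe_piMap] at hinj hsurj
  refine ⟨inferInstance, ?_, ?_, ?_⟩
  · have hS := shortExact_of_linearMap hinj hex hsurj
    exact (hS.hasProjectiveDimensionLT_X₃_iff 0 ((IsProjective.iff_projective _).1 hP)).2
      (projective_iff_hasProjectiveDimensionLT_one.1 ((IsProjective.iff_projective _).1 hQ))
  -- Extend `φ` on each factor of the syzygy separately: `m i` is the image chosen for the generator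
  -- of the projective cover of summand `i`.
  · refine subsingleton_ext_one_of_extends hinj hex hsurj fun φ => ?_
    have hm := fun i : Fin n => h.op.exists_tilt_extension
      (i := i) (φ (Pi.single i (h.op.gen (tiltSyzygy n k i) 0))) (by
        rw [← map_smul, ← Pi.single_smul, h.op.idem_smul_gen])
    choose m hm hm' using hm
    refine ⟨LinearMap.lsum Aᵐᵒᵖ _ ℕ fun i => h.op.cyclicLift (tiltTop n k i) 0 (m i), ?_⟩
    refine LinearMap.pi_ext' fun i => h.op.hom_ext ?_
    refine (congrArg _ (piMap_single _ i _)).trans ?_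
    refine (LinearMap.lsum_piSingle Aᵐᵒᵖ _ ℕ _ i _).trans ?_
    rw [h.op.cyclicLift_gen_path, map_smul, h.op.cyclicLift_gen (hm i) (by simp), hm']
    rfl
  · have hinj' := Function.Injective.piMap fun j : Fin n => h.op.cyclicLift_tiltTop_injective hkn j.2
    have hex' := exact_piMap fun j : Fin n => h.op.cyclicLift_tiltTop_exact j.2
    have hsurj' := Function.Surjective.piMap fun j : Fin n => h.op.cyclicLift_surjective
      (t := tiltTop n k j) (Nat.zero_le (j + 1 : ℕ))
    rw [← LinearMap.coe_piMap] at hinj' hsurj'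
    let e : A ≃ₗ[Aᵐᵒᵖ] (∀ j : Fin n, h.op.Cyclic j 0) :=
      (regularRightModuleEquiv A).trans (LinearEquiv.ofBijective _ h.op.pi_smul_gen_bijective)
    refine ⟨ModuleCat.of Aᵐᵒᵖ (∀ j : Fin n, h.op.Cyclic (tiltTop n k j) 0),
      ModuleCat.of Aᵐᵒᵖ (∀ j : Fin n, h.op.Cyclic (tiltTop n k j) (j + 1)),
      LinearMap.piMap (fun j : Fin n => h.op.cyclicLift j 0
        (MulOpposite.op (r (tiltTop n k j) j) • h.op.gen (tiltTop n k j) 0)) ∘ₗ e.toLinearMap,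
      LinearMap.piMap _, ?_, ?_, ?_, ?_, hsurj'⟩
    rotate_left 2
    · exact hinj'.comp e.injective
    · intro y
      refine (hex' y).trans ?_
      rw [LinearMap.coe_comp]
      exact (e.surjective.range_comp _) ▸ Iff.rfl
    · refine inAdd_pi fun j => h.op.exists_retract_tilt (Or.inl ?_)
      by_cases hjk : (j : ℕ) + 1 < k
      · exact ⟨j, rfl, if_pos (by omega)⟩
      -- Summand `k - 1` is the whole of `P_{n-1}`: its top is already `n - 1` and its cut is still
      -- `0`.
      · refine ⟨⟨k - 1, by omega⟩, ?_, if_pos (show k - 1 < k by omega)⟩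
        rw [tiltTop, tiltTop, if_neg (show ¬ k - 1 + 1 < k by omega), if_neg hjk]
    · refine inAdd_pi fun j => h.op.exists_retract_tilt ?_
      -- In these cases the top for `j` is `j` itself, so the cokernel is zero; otherwise it is
      -- summand `j + 1`, with cut `j + 1 ≥ k`.
      by_cases hj : (j : ℕ) + 1 < k ∨ (j : ℕ) = n - 1
      · refine Or.inr (h.op.subsingleton_cyclic_of_lt ?_)
        unfold tiltTop
        split_ifs <;> omega
      · refine Or.inl ⟨⟨j + 1, by omega⟩, ?_, if_neg (show ¬ (j : ℕ) + 1 < k by omega)⟩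
        rw [tiltTop, tiltTop, if_neg (show ¬ (j : ℕ) + 1 + 1 < k by omega),
          if_neg (show ¬ (j : ℕ) + 1 < k by omega)]

theorem IsChainSystem.isEndOfTilting {K A : Type u} [Field K] [Ring A] [Algebra K A] {n k : ℕ}
    {r : ℕ → ℕ → A} (h : IsChainSystem K n k r) (hk : 2 ≤ k) (hkn : k < n) :
    IsEndOfTilting K A (BoundAlgebra K n (k + 1)) :=
  ⟨h.op.Tilt, inferInstance, inferInstance, inferInstance, inferInstance, h.isTilting hk hkn,
    ⟨(h.op.isChainSystem_tiltEnd hkn).boundAlgebraEquiv.symm⟩⟩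

theorem IsChainSystem.exists_succ {K A : Type u} [Field K] [Ring A] [Algebra K A] {n k : ℕ}
    {r : ℕ → ℕ → A} (h : IsChainSystem K n k r) (hkn : k < n) :
    ∃ r' : ℕ → ℕ → BoundAlgebra K n (k + 1), IsChainSystem K n (k + 1) r' :=
  have h' := h.op.isChainSystem_tiltEnd hkn
  ⟨_, h'.map h'.boundAlgebraEquiv.symm⟩

/-- For `k = 2` there are no relations. In the inductive step, nonvanishing of the good paths is
transported from `End T`, where the corresponding maps are visibly nonzero. -/
theorem exists_isChainSystem_boundAlgebra (K : Type u) [Field K] {n k : ℕ} (hk : 2 ≤ k) (hkn : k ≤ n) :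
    ∃ r : ℕ → ℕ → BoundAlgebra K n k, IsChainSystem K n k r := by
  induction k, hk using Nat.le_induction with
  | base => exact ⟨_, (PathAlgebra.isChainSystem K n).map
      (PathAlgebra.isChainSystem K n).boundAlgebraEquiv.symm⟩
  | succ k hk ih =>
    obtain ⟨r, h⟩ := ih (by omega)
    exact h.exists_succ hkn

theorem proposition5p1 (K : Type u) [Field K] (n : ℕ) (hn : 2 ≤ n) :
    (∀ k : ℕ, 2 ≤ k → k ≤ n →
      globalDimension (BoundAlgebra K n k) = ((k - 1 : ℕ) : WithBot ℕ∞)) ∧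
    (∀ k : ℕ, 2 ≤ k → k < n →
      IsEndOfTilting K (BoundAlgebra K n k) (BoundAlgebra K n (k + 1))) ∧
    (∃ B : ℕ → AlgCat.{u} K,
      Nonempty (B 0 ≃ₐ[K] PathAlgebra K (LinearA n)) ∧ IsHereditary (B 0) ∧
      (∀ i : ℕ, i < n - 2 → IsEndOfTilting K (B i) (B (i + 1))) ∧
      globalDimension (B (n - 2)) = ((n - 1 : ℕ) : WithBot ℕ∞)) := by
  have h1 : ∀ k : ℕ, 2 ≤ k → k ≤ n →
      globalDimension (BoundAlgebra K n k) = ((k - 1 : ℕ) : WithBot ℕ∞) := fun k hk hkn => by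
    obtain ⟨r, h⟩ := exists_isChainSystem_boundAlgebra K hk hkn
    exact h.globalDimension_eq hk hkn
  have h2 : ∀ k : ℕ, 2 ≤ k → k < n →
      IsEndOfTilting K (BoundAlgebra K n k) (BoundAlgebra K n (k + 1)) := fun k hk hkn => by
    obtain ⟨r, h⟩ := exists_isChainSystem_boundAlgebra K hk hkn.le
    exact h.isEndOfTilting hk hkn
  refine ⟨h1, h2, fun i => AlgCat.of K (BoundAlgebra K n (i + 2)),
    ⟨(PathAlgebra.isChainSystem K n).boundAlgebraEquiv⟩, ?_, ?_, ?_⟩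
  · exact isHereditary_of_globalDimension_le_one (h1 2 le_rfl hn).le
  · exact fun i hi => h2 (i + 2) (by omega) (by omega)
  · have := h1 (n - 2 + 2) (by omega) (by omega)
    rwa [show n - 2 + 2 - 1 = n - 1 by omega] at this
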